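/- Let $(L^k,g)$ be an oriented smooth Riemannian manifold of dimension $k\ge 2$ and $(M^n,h)$ a smooth Riemannian manifold of dimension $n$, neither assumed compact. Let $\alpha\in\Omega^k(M)$ be a calibration, that is, a smooth $k$-form with $\alpha(v_1,\dots,v_k)\le |v_1\wedge\cdots\wedge v_k|$ for all $x\in M$ and all $v_1,\dots,v_k\in T_xM$, where $|v_1\wedge\cdots\wedge v_k|^2=\det\big(h(v_i,v_j)\big)$. Let $u\colon (L^k,g)\to(M^n,h)$ be a Smith immersion with respect to $\alpha$, that is, a smooth map such that at all points of $L$ $$u^*\alpha=\frac{1}{(\sqrt k)^k}\,|du|^k\,\mathsf{vol}_L,\qquad u^*h=\frac1k\,|du|^2\,g,$$ where $|du|^2=\operatorname{tr}_g(u^*h)$ and $\mathsf{vol}_L$ is the Riemannian volume form of the oriented manifold $(L,g)$ (so $du$ may vanish at some points). If $d\alpha=0$, then $u$ is $k$-harmonic: the section $|du|^{k-2}du$ of $T^*L\otimes u^*TM$ is differentiable, and the $k$-tension $$\tau_k(u)=\operatorname{Div}\big(|du|^{k-2}du\big)=\operatorname{tr}_g\nabla\big(|du|^{k-2}du\big)\in\Gamma(u^*TM)$$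 vanishes at every point of $L$, where $\nabla$ is the connection on $T^*L\otimes u^*TM$ induced by the Levi-Civita connections of $g$ and $h$. -/

import Mathlib

open scoped Manifold ContDiff Topology Bundle

noncomputable section

namespace SmithMaps

/-- The tangent spaces of an `m`-manifold have dimension `m`. -/
instance tangentSpace_finiteDimensional {m : ℕ} {X : Type*} [TopologicalSpace X]
    [ChartedSpace (EuclideanSpace ℝ (Fin m)) X] (x : X) :
    FiniteDimensional ℝ (TangentSpace (𝓡 m) x) :=
  inferInstanceAs (FiniteDimensional ℝ (EuclideanSpace ℝ (Fin m)))

instance tangentSpace_finrank {m : ℕ} {X : Type*} [TopologicalSpace X]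
    [ChartedSpace (EuclideanSpace ℝ (Fin m)) X] (x : X) :
    Fact (Module.finrank ℝ (TangentSpace (𝓡 m) x) = m) :=
  ⟨finrank_euclideanSpace_fin (𝕜 := ℝ) (n := m)⟩

/-! ### Charts, coordinate frames, Christoffel symbols -/

/-- The smooth charts of a smooth `m`-manifold. -/
abbrev smoothCharts (m : ℕ) (X : Type*) [TopologicalSpace X]
    [ChartedSpace (EuclideanSpace ℝ (Fin m)) X] :
    Set (OpenPartialHomeomorph X (EuclideanSpace ℝ (Fin m))) :=
  IsManifold.maximalAtlas (𝓡 m) ∞ X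

/-- The partial derivative `∂ᵢ f (y)` of a real function on `ℝᵐ`. -/
def pderiv {m : ℕ} (i : Fin m) (f : EuclideanSpace ℝ (Fin m) → ℝ)
    (y : EuclideanSpace ℝ (Fin m)) : ℝ :=
  fderiv ℝ f y (EuclideanSpace.single i 1)

/-- The coordinate vector `∂ᵢ` of the chart `φ`, at the point with coordinates `y`. -/
def coordVec {m : ℕ} {X : Type*} [TopologicalSpace X]
    [ChartedSpace (EuclideanSpace ℝ (Fin m)) X]
    (φ : OpenPartialHomeomorph X (EuclideanSpace ℝ (Fin m))) (i : Fin m)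
    (y : EuclideanSpace ℝ (Fin m)) : TangentSpace (𝓡 m) (φ.symm y) :=
  mfderiv (𝓡 m) (𝓡 m) φ.symm y
    (show TangentSpace (𝓡 m) y from (EuclideanSpace.single i (1 : ℝ) : EuclideanSpace ℝ (Fin m)))

/-- The `a`-th component, in the chart `φ`, of a tangent vector at `x`. -/
def coordComp {m : ℕ} {X : Type*} [TopologicalSpace X]
    [ChartedSpace (EuclideanSpace ℝ (Fin m)) X]
    (φ : OpenPartialHomeomorph X (EuclideanSpace ℝ (Fin m))) (a : Fin m) (x : X)
    (v : TangentSpace (𝓡 m) x) : ℝ :=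
  (show EuclideanSpace ℝ (Fin m) from mfderiv (𝓡 m) (𝓡 m) φ x v) a

/-- The matrix `gᵢⱼ` of the Riemannian metric in the chart `φ`. -/
def metricMatrix {m : ℕ} {X : Type*} [TopologicalSpace X]
    [ChartedSpace (EuclideanSpace ℝ (Fin m)) X]
    [Bundle.RiemannianBundle (fun x : X ↦ TangentSpace (𝓡 m) x)]
    (φ : OpenPartialHomeomorph X (EuclideanSpace ℝ (Fin m)))
    (y : EuclideanSpace ℝ (Fin m)) : Matrix (Fin m) (Fin m) ℝ :=
  Matrix.gram ℝ (fun i ↦ coordVec φ i y)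

/-- The Christoffel symbols `Γˡᵢⱼ` of the Levi-Civita connection in the chart `φ`. -/
def christoffel {m : ℕ} {X : Type*} [TopologicalSpace X]
    [ChartedSpace (EuclideanSpace ℝ (Fin m)) X]
    [Bundle.RiemannianBundle (fun x : X ↦ TangentSpace (𝓡 m) x)]
    (φ : OpenPartialHomeomorph X (EuclideanSpace ℝ (Fin m)))
    (l i j : Fin m) (y : EuclideanSpace ℝ (Fin m)) : ℝ :=
  (1 / 2) * ∑ r, (metricMatrix φ y)⁻¹ l r *
    (pderiv i (fun z ↦ metricMatrix φ z j r) y + pderiv j (fun z ↦ metricMatrix φ z i r) y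
      - pderiv r (fun z ↦ metricMatrix φ z i j) y)

/-! ### Orientations -/

/-- The coordinate frame of the chart `φ`, at the point with coordinates `y`, is positively
oriented for the given orientations of the tangent spaces. -/
def IsPositiveFrame {k : ℕ} {X : Type*} [TopologicalSpace X]
    [ChartedSpace (EuclideanSpace ℝ (Fin k)) X]
    (o : ∀ x : X, Orientation ℝ (TangentSpace (𝓡 k) x) (Fin k))
    (φ : OpenPartialHomeomorph X (EuclideanSpace ℝ (Fin k)))
    (y : EuclideanSpace ℝ (Fin k)) : Prop :=
  ∃ b : Module.Basis (Fin k) ℝ (TangentSpace (𝓡 k) (φ.symm y)),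
    (∀ i, b i = coordVec φ i y) ∧ b.orientation = o (φ.symm y)

/-- An orientation of a smooth manifold: an orientation of each tangent space that is locally
constant in every smooth chart. -/
structure ManifoldOrientation (k : ℕ) (X : Type*) [TopologicalSpace X]
    [ChartedSpace (EuclideanSpace ℝ (Fin k)) X] where
  orient : ∀ x : X, Orientation ℝ (TangentSpace (𝓡 k) x) (Fin k)
  locally_constant : ∀ φ ∈ smoothCharts k X, ∀ y ∈ φ.target,
    ∀ᶠ z in 𝓝 y, (IsPositiveFrame orient φ z ↔ IsPositiveFrame orient φ y)

/-! ### Differential forms and calibrations -/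

/-- A (not necessarily smooth) differential `k`-form. -/
abbrev RoughForm (k n : ℕ) (X : Type*) [TopologicalSpace X]
    [ChartedSpace (EuclideanSpace ℝ (Fin n)) X] : Type _ :=
  ∀ x : X, (TangentSpace (𝓡 n) x) [⋀^Fin k]→L[ℝ] ℝ

/-- The form `α` read in the chart `ψ`, that is the pullback of `α` by `ψ⁻¹`. -/
def formInChart {k n : ℕ} {X : Type*} [TopologicalSpace X]
    [ChartedSpace (EuclideanSpace ℝ (Fin n)) X] (α : RoughForm k n X)
    (ψ : OpenPartialHomeomorph X (EuclideanSpace ℝ (Fin n)))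
    (z : EuclideanSpace ℝ (Fin n)) : (EuclideanSpace ℝ (Fin n)) [⋀^Fin k]→L[ℝ] ℝ :=
  (α (ψ.symm z)).compContinuousLinearMap
    (show EuclideanSpace ℝ (Fin n) →L[ℝ] TangentSpace (𝓡 n) (ψ.symm z) from
      mfderiv (𝓡 n) (𝓡 n) ψ.symm z)

/-- `α` is smooth: its expression in every smooth chart is smooth. -/
def IsSmoothForm {k n : ℕ} {X : Type*} [TopologicalSpace X]
    [ChartedSpace (EuclideanSpace ℝ (Fin n)) X] (α : RoughForm k n X) : Prop :=
  ∀ ψ ∈ smoothCharts n X, ContDiffOn ℝ ∞ (formInChart α ψ) ψ.target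

/-- `dα = 0`: the exterior derivative of `α`, computed in any smooth chart, vanishes. -/
def IsClosedForm {k n : ℕ} {X : Type*} [TopologicalSpace X]
    [ChartedSpace (EuclideanSpace ℝ (Fin n)) X] (α : RoughForm k n X) : Prop :=
  ∀ ψ ∈ smoothCharts n X, ∀ z ∈ ψ.target, extDeriv (formInChart α ψ) z = 0

/-- A calibration (not necessarily closed): a smooth `k`-form with
`α(v₁, …, v_k) ≤ |v₁ ∧ ⋯ ∧ v_k|`, where `|v₁ ∧ ⋯ ∧ v_k|² = det ⟨vᵢ, vⱼ⟩`. -/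
structure IsCalibration {k n : ℕ} {X : Type*} [TopologicalSpace X]
    [ChartedSpace (EuclideanSpace ℝ (Fin n)) X]
    [Bundle.RiemannianBundle (fun x : X ↦ TangentSpace (𝓡 n) x)] (α : RoughForm k n X) : Prop where
  smooth : IsSmoothForm α
  le : ∀ (x : X) (v : Fin k → TangentSpace (𝓡 n) x), α x v ≤ √(Matrix.gram ℝ v).det

/-! ### Smith immersions -/

/-- The norm `|du_x|`, with `|du_x|² = ∑ᵢ |du_x(eᵢ)|²` for an orthonormal basis `e` of `T_x L`. -/
def normDu (k n : ℕ) {L M : Type*}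
    [TopologicalSpace L] [ChartedSpace (EuclideanSpace ℝ (Fin k)) L]
    [Bundle.RiemannianBundle (fun x : L ↦ TangentSpace (𝓡 k) x)]
    [TopologicalSpace M] [ChartedSpace (EuclideanSpace ℝ (Fin n)) M]
    [Bundle.RiemannianBundle (fun x : M ↦ TangentSpace (𝓡 n) x)]
    (u : L → M) (x : L) : ℝ :=
  √(∑ i, ‖mfderiv (𝓡 k) (𝓡 n) u x (stdOrthonormalBasis ℝ (TangentSpace (𝓡 k) x) i)‖ ^ 2)

/-- `u : (L, g) → (M, h)` is a Smith immersion with respect to `α`: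
it is smooth, `u^* α = (1 / √k ^ k) |du|^k vol_L` and `u^* h = (1 / k) |du|² g`. -/
structure IsSmithImmersion {k n : ℕ} {L M : Type*}
    [TopologicalSpace L] [ChartedSpace (EuclideanSpace ℝ (Fin k)) L]
    [Bundle.RiemannianBundle (fun x : L ↦ TangentSpace (𝓡 k) x)]
    [TopologicalSpace M] [ChartedSpace (EuclideanSpace ℝ (Fin n)) M]
    [Bundle.RiemannianBundle (fun x : M ↦ TangentSpace (𝓡 n) x)]
    (o : ManifoldOrientation k L) (α : RoughForm k n M) (u : L → M) : Prop where
  smooth : ContMDiff (𝓡 k) (𝓡 n) ∞ u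
  pullback_form : ∀ (x : L) (v : Fin k → TangentSpace (𝓡 k) x),
    α (u x) (fun i ↦ mfderiv (𝓡 k) (𝓡 n) u x (v i)) =
      1 / √(k : ℝ) ^ k * normDu k n u x ^ k * (o.orient x).volumeForm v
  pullback_metric : ∀ (x : L) (v w : TangentSpace (𝓡 k) x),
    inner ℝ (mfderiv (𝓡 k) (𝓡 n) u x v) (mfderiv (𝓡 k) (𝓡 n) u x w) =
      1 / (k : ℝ) * normDu k n u x ^ 2 * inner ℝ v w

/-! ### The `p`-tension -/

/-- The component `Aᵃⱼ`, as a function of the coordinates `y`, of a section `A` of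
`T^*L ⊗ u^*TM` with respect to a chart `φ` of `L` and a chart `ψ` of `M`. -/
def sectionComp {k n : ℕ} {L M : Type*}
    [TopologicalSpace L] [ChartedSpace (EuclideanSpace ℝ (Fin k)) L]
    [TopologicalSpace M] [ChartedSpace (EuclideanSpace ℝ (Fin n)) M]
    {u : L → M} (A : ∀ x : L, TangentSpace (𝓡 k) x →L[ℝ] TangentSpace (𝓡 n) (u x))
    (φ : OpenPartialHomeomorph L (EuclideanSpace ℝ (Fin k)))
    (ψ : OpenPartialHomeomorph M (EuclideanSpace ℝ (Fin n)))
    (a : Fin n) (j : Fin k) (y : EuclideanSpace ℝ (Fin k)) : ℝ :=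
  coordComp ψ a (u (φ.symm y)) (A (φ.symm y) (coordVec φ j y))

/-- The component `(∇ᵢ A)ᵃⱼ` of the covariant derivative of a section `A` of `T^*L ⊗ u^*TM`, for
the connection induced by the Levi-Civita connections of `L` and `M`. -/
def covDerivComp {k n : ℕ} {L M : Type*}
    [TopologicalSpace L] [ChartedSpace (EuclideanSpace ℝ (Fin k)) L]
    [Bundle.RiemannianBundle (fun x : L ↦ TangentSpace (𝓡 k) x)]
    [TopologicalSpace M] [ChartedSpace (EuclideanSpace ℝ (Fin n)) M]
    [Bundle.RiemannianBundle (fun x : M ↦ TangentSpace (𝓡 n) x)]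
    {u : L → M} (A : ∀ x : L, TangentSpace (𝓡 k) x →L[ℝ] TangentSpace (𝓡 n) (u x))
    (φ : OpenPartialHomeomorph L (EuclideanSpace ℝ (Fin k)))
    (ψ : OpenPartialHomeomorph M (EuclideanSpace ℝ (Fin n)))
    (a : Fin n) (i j : Fin k) (y : EuclideanSpace ℝ (Fin k)) : ℝ :=
  pderiv i (sectionComp A φ ψ a j) y
    - ∑ l, christoffel φ l i j y * sectionComp A φ ψ a l y
    + ∑ b, ∑ c, christoffel ψ a b c (ψ (u (φ.symm y)))
        * pderiv i (fun z ↦ ψ (u (φ.symm z)) b) y * sectionComp A φ ψ c j y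

/-- The component `(Div A)ᵃ = gⁱʲ (∇ᵢ A)ᵃⱼ` of the divergence of a section `A` of
`T^*L ⊗ u^*TM`. -/
def divergenceComp {k n : ℕ} {L M : Type*}
    [TopologicalSpace L] [ChartedSpace (EuclideanSpace ℝ (Fin k)) L]
    [Bundle.RiemannianBundle (fun x : L ↦ TangentSpace (𝓡 k) x)]
    [TopologicalSpace M] [ChartedSpace (EuclideanSpace ℝ (Fin n)) M]
    [Bundle.RiemannianBundle (fun x : M ↦ TangentSpace (𝓡 n) x)]
    {u : L → M} (A : ∀ x : L, TangentSpace (𝓡 k) x →L[ℝ] TangentSpace (𝓡 n) (u x))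
    (φ : OpenPartialHomeomorph L (EuclideanSpace ℝ (Fin k)))
    (ψ : OpenPartialHomeomorph M (EuclideanSpace ℝ (Fin n)))
    (a : Fin n) (y : EuclideanSpace ℝ (Fin k)) : ℝ :=
  ∑ i, ∑ j, (metricMatrix φ y)⁻¹ i j * covDerivComp A φ ψ a i j y

/-- The section `|du|^(p-2) du` of `T^*L ⊗ u^*TM`, for `p ≥ 2`. -/
def pFlux (k n : ℕ) {L M : Type*}
    [TopologicalSpace L] [ChartedSpace (EuclideanSpace ℝ (Fin k)) L]
    [Bundle.RiemannianBundle (fun x : L ↦ TangentSpace (𝓡 k) x)]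
    [TopologicalSpace M] [ChartedSpace (EuclideanSpace ℝ (Fin n)) M]
    [Bundle.RiemannianBundle (fun x : M ↦ TangentSpace (𝓡 n) x)]
    (p : ℝ) (u : L → M) (x : L) : TangentSpace (𝓡 k) x →L[ℝ] TangentSpace (𝓡 n) (u x) :=
  normDu k n u x ^ (p - 2) • mfderiv (𝓡 k) (𝓡 n) u x

/-- The component `τ_p(u)ᵃ` of the `p`-tension `τ_p(u) = Div (|du|^(p-2) du)`. -/
def pTensionComp (k n : ℕ) {L M : Type*}
    [TopologicalSpace L] [ChartedSpace (EuclideanSpace ℝ (Fin k)) L]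
    [Bundle.RiemannianBundle (fun x : L ↦ TangentSpace (𝓡 k) x)]
    [TopologicalSpace M] [ChartedSpace (EuclideanSpace ℝ (Fin n)) M]
    [Bundle.RiemannianBundle (fun x : M ↦ TangentSpace (𝓡 n) x)]
    (p : ℝ) (u : L → M)
    (φ : OpenPartialHomeomorph L (EuclideanSpace ℝ (Fin k)))
    (ψ : OpenPartialHomeomorph M (EuclideanSpace ℝ (Fin n)))
    (a : Fin n) (y : EuclideanSpace ℝ (Fin k)) : ℝ :=
  divergenceComp (pFlux k n p u) φ ψ a y

/-- `u` is `p`-harmonic, `τ_p(u) = 0`: at every point of `L` and in all smooth charts of `L` and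
`M` around that point and its image, `|du|^(p-2) du` is differentiable (so that no derivative in
`τ_p(u)` is a default value) and all components of `τ_p(u)` vanish. -/
def IsPHarmonic (k n : ℕ) {L M : Type*}
    [TopologicalSpace L] [ChartedSpace (EuclideanSpace ℝ (Fin k)) L]
    [Bundle.RiemannianBundle (fun x : L ↦ TangentSpace (𝓡 k) x)]
    [TopologicalSpace M] [ChartedSpace (EuclideanSpace ℝ (Fin n)) M]
    [Bundle.RiemannianBundle (fun x : M ↦ TangentSpace (𝓡 n) x)]
    (p : ℝ) (u : L → M) : Prop :=
  ∀ φ ∈ smoothCharts k L, ∀ ψ ∈ smoothCharts n M, ∀ x ∈ φ.source, u x ∈ ψ.source →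
    (∀ a j, DifferentiableAt ℝ (sectionComp (pFlux k n p u) φ ψ a j) (φ x)) ∧
    ∀ a, pTensionComp k n p u φ ψ a (φ x) = 0

end SmithMaps

end

namespace SmithMaps

/-! ### Coordinate expressions on manifolds -/

section Charts

variable {m : ℕ} {X : Type*} [TopologicalSpace X]
    [ChartedSpace (EuclideanSpace ℝ (Fin m)) X]
    {φ : OpenPartialHomeomorph X (EuclideanSpace ℝ (Fin m))}

/-! Work in charts, with `U` the map, `β` the form, `g` and `H` the metrics, `v_i = ∂_i U` and `l =
|du|/√k`. The two Smith equations say that `β(v)² ≤ det(v_i · v_j)` is an equality along `u`, so its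
first variations vanish. Varying one vector gives the first cousin principle
`apply_update_eq_of_calibrated`: up to the orientation sign and a constant, `√det g` times the flux
`|du|^(k-2) du`, with its domain index raised and its target index `b` lowered, is `W_b^j = β(v_1,
…, e_b, …, v_k)` with `e_b` in slot `j`. This expression is polynomial in `dU`, so the flux is
differentiable even at zeros of `du`, where `|du|` itself need not be. In the divergence `∑_j ∂_j
W_b^j` the second derivatives of `U` cancel by antisymmetry, and `dβ = 0` turns the rest into `(∂_b
β)(v)` (`sum_fderiv_apply_update`). Varying the base point in the same equality
(`fderiv_apply_eq_of_calibrated`) evaluates this as `½ l^(k-2) √det g · g^{ij} (∂_b H)(v_i, v_j)`.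
That is precisely the Christoffel term of the target that survives when the index of the tension is
lowered, so the tension is zero (`divergence_eq_zero`). -/

theorem mdifferentiable_of_mem_smoothCharts (hφ : φ ∈ smoothCharts m X) :
    φ.MDifferentiable (𝓡 m) (𝓡 m) :=
  ⟨fun _ hx => ((contMDiffAt_of_mem_maximalAtlas hφ hx).mdifferentiableAt
      (by simp)).mdifferentiableWithinAt,
    fun _ hx => ((contMDiffAt_symm_of_mem_maximalAtlas hφ hx).mdifferentiableAt
      (by simp)).mdifferentiableWithinAt⟩

/-- The coordinate field is the tangent map of `φ.symm` composed with a constant section of the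
tangent bundle of `ℝᵐ`. Phrased in the tangent bundle, it feeds directly into differentiability of
the inner product. -/
theorem mdifferentiableAt_coordVec [IsManifold (𝓡 m) ∞ X] (hφ : φ ∈ smoothCharts m X)
    {y : EuclideanSpace ℝ (Fin m)} (hy : y ∈ φ.target) (i : Fin m) :
    MDifferentiableAt (𝓡 m) ((𝓡 m).prod (𝓡 m))
      (fun z => (⟨φ.symm z, coordVec φ i z⟩ : TangentBundle (𝓡 m) X)) y := by
  have : IsManifold (𝓡 m) 1 X := .of_le (n := ∞) (by simp)
  let e : EuclideanSpace ℝ (Fin m) → TangentBundle (𝓡 m) (EuclideanSpace ℝ (Fin m)) :=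
    fun z => ⟨z, EuclideanSpace.single i (1 : ℝ)⟩
  have h1 := (contMDiffOn_symm_of_mem_maximalAtlas hφ).contMDiffOn_tangentMapWithin (m := 1)
    (by norm_num; exact ENat.LEInfty.out) φ.open_target.uniqueMDiffOn
  have h2 : ContMDiff (𝓡 m) (𝓡 m).tangent 1 e :=
    contMDiff_vectorSpace_iff_contDiff.2 contDiff_const
  have h3 := (h1.contMDiffAt (x := e y)
    ((φ.open_target.preimage (FiberBundle.continuous_proj _ _)).mem_nhds hy)).comp y
      h2.contMDiffAt
  refine (h3.mdifferentiableAt one_ne_zero).congr_of_eventuallyEq ?_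
  filter_upwards [φ.open_target.mem_nhds hy] with z hz
  simp only [e, Function.comp_apply, tangentMapWithin, mfderivWithin_of_isOpen φ.open_target hz]
  rfl

theorem differentiableAt_metricMatrix [IsManifold (𝓡 m) ∞ X]
    [Bundle.RiemannianBundle (fun x : X ↦ TangentSpace (𝓡 m) x)]
    [H : IsContMDiffRiemannianBundle (𝓡 m) ∞ (EuclideanSpace ℝ (Fin m))
      (fun x : X ↦ TangentSpace (𝓡 m) x)] (hφ : φ ∈ smoothCharts m X)
    {y : EuclideanSpace ℝ (Fin m)} (hy : y ∈ φ.target) (i j : Fin m) :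
    DifferentiableAt ℝ (fun z ↦ metricMatrix φ z i j) y := by
  have : IsContMDiffRiemannianBundle (𝓡 m) 1 (EuclideanSpace ℝ (Fin m))
      (fun x : X ↦ TangentSpace (𝓡 m) x) := H.of_le (by simp)
  rw [← mdifferentiableAt_iff_differentiableAt]
  exact (mdifferentiableAt_coordVec hφ hy i).inner_bundle (mdifferentiableAt_coordVec hφ hy j)

theorem posDef_metricMatrix [Bundle.RiemannianBundle (fun x : X ↦ TangentSpace (𝓡 m) x)]
    (hφ : φ ∈ smoothCharts m X)
    {y : EuclideanSpace ℝ (Fin m)} (hy : y ∈ φ.target) : (metricMatrix φ y).PosDef := by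
  refine Matrix.posDef_gram_of_linearIndependent ?_
  have h := (mdifferentiable_of_mem_smoothCharts hφ).symm.mfderiv_injective hy
  have h2 := (EuclideanSpace.basisFun (Fin m) ℝ).toBasis.linearIndependent
  have := h2.map' (mfderiv (𝓡 m) (𝓡 m) φ.symm y).toLinearMap (LinearMap.ker_eq_bot.2 h)
  convert this using 1
  · ext1 i
    simp [coordVec]
    rfl
  all_goals rfl

theorem inner_sum_smul_sum_smul {ι V : Type*} [Fintype ι] [NormedAddCommGroup V]
    [InnerProductSpace ℝ V] (e : ι → V) (p q : ι → ℝ) :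
    inner ℝ (∑ a, p a • e a) (∑ b, q b • e b) = ∑ a, ∑ b, Matrix.gram ℝ e a b * p a * q b := by
  simp_rw [sum_inner, inner_sum, real_inner_smul_left, real_inner_smul_right, Matrix.gram_apply]
  refine Finset.sum_congr rfl fun a _ => Finset.sum_congr rfl fun b _ => by ring

theorem sum_coordComp_smul_coordVec (hφ : φ.MDifferentiable (𝓡 m) (𝓡 m))
    {y : EuclideanSpace ℝ (Fin m)} (hy : y ∈ φ.target) (v : TangentSpace (𝓡 m) (φ.symm y)) :
    ∑ a, coordComp φ a _ v • coordVec φ a y = v := by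
  have h := congrArg (· v) (hφ.symm_comp_deriv (φ.map_target hy))
  rw [φ.right_inv hy] at h
  let A : EuclideanSpace ℝ (Fin m) →L[ℝ] TangentSpace (𝓡 m) (φ.symm y) :=
    mfderiv (𝓡 m) (𝓡 m) φ.symm y
  let w : EuclideanSpace ℝ (Fin m) := mfderiv (𝓡 m) (𝓡 m) φ (φ.symm y) v
  have h2 : ∑ a, w a • (EuclideanSpace.single a (1:ℝ) : EuclideanSpace ℝ (Fin m)) = w := by
    simpa using (EuclideanSpace.basisFun (Fin m) ℝ).sum_repr w
  have h3 : A w = v := h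
  rw [← h2, map_sum] at h3
  simp_rw [map_smul] at h3
  exact h3

theorem inner_eq_sum_metricMatrix [Bundle.RiemannianBundle (fun x : X ↦ TangentSpace (𝓡 m) x)]
    (hφ : φ.MDifferentiable (𝓡 m) (𝓡 m)) {x : X} (hx : x ∈ φ.source)
    (v w : TangentSpace (𝓡 m) x) :
    inner ℝ v w
      = ∑ a, ∑ b, metricMatrix φ (φ x) a b * coordComp φ a x v * coordComp φ b x w := by
  obtain ⟨y, hy, rfl⟩ : ∃ y ∈ φ.target, φ.symm y = x := ⟨φ x, φ.map_source hx, φ.left_inv hx⟩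
  rw [φ.right_inv hy]
  have := inner_sum_smul_sum_smul (fun a => coordVec φ a y) (fun a => coordComp φ a _ v)
    (fun a => coordComp φ a _ w)
  rw [metricMatrix, ← this]
  exact congrArg₂ _ (sum_coordComp_smul_coordVec hφ hy v).symm
    (sum_coordComp_smul_coordVec hφ hy w).symm

theorem form_eq_formInChart {k} (α : RoughForm k m X) (hφ : φ.MDifferentiable (𝓡 m) (𝓡 m))
   {x} (hx : x ∈ φ.source) (v : Fin k → TangentSpace (𝓡 m) x) :
   α x v = formInChart α φ (φ x) (fun i => mfderiv (𝓡 m) (𝓡 m) φ x (v i)) := by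
  obtain ⟨y, hy, rfl⟩ : ∃ y ∈ φ.target, φ.symm y = x := ⟨φ x, φ.map_source hx, φ.left_inv hx⟩
  rw [φ.right_inv hy]
  have h := (hφ.symm_comp_deriv (φ.map_target hy))
  rw [φ.right_inv hy] at h
  change _ = α (φ.symm y) fun i => mfderiv (𝓡 m) (𝓡 m) φ.symm y (mfderiv (𝓡 m) (𝓡 m) φ _ (v i))
  congr 1
  ext1 i
  exact (congrArg (· (v i)) h).symm

end Charts

/-! ### Volume forms, coordinate frames and maps read in charts -/

/-- In an oriented orthonormal basis `e` the volume form is `e.det`, while the Gram determinant is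
the square of `e.det b`; the sign lost in the square root is the orientation of `b`. -/
theorem volumeForm_basis {k : ℕ} (hk : 0 < k) {V : Type*} [NormedAddCommGroup V]
    [InnerProductSpace ℝ V] [Fact (Module.finrank ℝ V = k)] (o : Orientation ℝ V (Fin k))
    (b : Module.Basis (Fin k) ℝ V) :
    (b.orientation = o → o.volumeForm b = √(Matrix.gram ℝ b).det) ∧
    (b.orientation ≠ o → o.volumeForm b = -√(Matrix.gram ℝ b).det) := by
  let e := o.finOrthonormalBasis hk Fact.out
  have he : e.toBasis.orientation = o := o.finOrthonormalBasis_orientation hk Fact.out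
  have h1 : (Matrix.gram ℝ b).det = (e.toBasis.det b) ^ 2 := by
    rw [Matrix.gram_eq_conjTranspose_mul e b, Matrix.det_mul, Matrix.det_conjTranspose, sq]
    simp [Module.Basis.det_apply]
    rfl
  have h2 : b.orientation = o ↔ 0 < e.toBasis.det b := by
    rw [← Module.Basis.orientation_eq_iff_det_pos, he, eq_comm]
  rw [o.volumeForm_robust e he, h1, Real.sqrt_sq_eq_abs, Ne, h2]
  exact ⟨fun h => (abs_of_pos h).symm, fun h => by rw [abs_of_nonpos (not_lt.1 h), neg_neg]⟩

section Frames

variable {k : ℕ} {X : Type*} [TopologicalSpace X]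
    [ChartedSpace (EuclideanSpace ℝ (Fin k)) X]
    {φ : OpenPartialHomeomorph X (EuclideanSpace ℝ (Fin k))}

theorem exists_basis_coordVec (hφ : φ.MDifferentiable (𝓡 k) (𝓡 k))
    {y : EuclideanSpace ℝ (Fin k)} (hy : y ∈ φ.target) :
    ∃ b : Module.Basis (Fin k) ℝ (TangentSpace (𝓡 k) (φ.symm y)),
      ∀ i, b i = coordVec φ i y := by
  let A : EuclideanSpace ℝ (Fin k) →ₗ[ℝ] TangentSpace (𝓡 k) (φ.symm y) :=
    (mfderiv (𝓡 k) (𝓡 k) φ.symm y).toLinearMap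
  have hA : Function.Bijective A := hφ.symm.mfderiv_bijective hy
  refine ⟨(EuclideanSpace.basisFun (Fin k) ℝ).toBasis.map
    (LinearEquiv.ofBijective A hA), fun i => ?_⟩
  rw [Module.Basis.map_apply, LinearEquiv.ofBijective_apply, OrthonormalBasis.coe_toBasis,
    EuclideanSpace.basisFun_apply]
  rfl

open Classical in
theorem volumeForm_coordVec (hk : 0 < k)
    [Bundle.RiemannianBundle (fun x : X ↦ TangentSpace (𝓡 k) x)]
    (o : ∀ x : X, Orientation ℝ (TangentSpace (𝓡 k) x) (Fin k))
    (hφ : φ.MDifferentiable (𝓡 k) (𝓡 k))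
    {y : EuclideanSpace ℝ (Fin k)} (hy : y ∈ φ.target) :
    (o (φ.symm y)).volumeForm (fun i => coordVec φ i y)
      = (if IsPositiveFrame o φ y then 1 else -1) * √(metricMatrix φ y).det := by
  obtain ⟨b, hb⟩ := exists_basis_coordVec hφ hy
  have hb' : (fun i => coordVec φ i y) = b := funext fun i => (hb i).symm
  have hiff : IsPositiveFrame o φ y ↔ b.orientation = o (φ.symm y) := by
    refine ⟨fun ⟨c, hc, hco⟩ => ?_, fun h => ⟨b, hb, h⟩⟩
    rwa [show b = c from Module.Basis.eq_of_apply_eq fun i => (hb i).trans (hc i).symm]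
  have := volumeForm_basis hk (o (φ.symm y)) b
  rw [metricMatrix, hb']
  split_ifs with h
  · rw [one_mul]; exact this.1 (hiff.1 h)
  · rw [neg_one_mul]; exact this.2 (mt hiff.2 h)

theorem mfderiv_chart_comp {n : ℕ} {L M : Type*}
    [TopologicalSpace L] [ChartedSpace (EuclideanSpace ℝ (Fin k)) L] 
    [TopologicalSpace M] [ChartedSpace (EuclideanSpace ℝ (Fin n)) M] 
    {φ : OpenPartialHomeomorph L (EuclideanSpace ℝ (Fin k))}
    {ψ : OpenPartialHomeomorph M (EuclideanSpace ℝ (Fin n))}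
    (hφ : φ.MDifferentiable (𝓡 k) (𝓡 k)) (hψ : ψ.MDifferentiable (𝓡 n) (𝓡 n))
    {u : L → M} (hu : MDifferentiable (𝓡 k) (𝓡 n) u) {y : EuclideanSpace ℝ (Fin k)}
    (hy : y ∈ φ.target) (huy : u (φ.symm y) ∈ ψ.source) (j : Fin k) :
    (mfderiv (𝓡 n) (𝓡 n) ψ (u (φ.symm y))
      (mfderiv (𝓡 k) (𝓡 n) u (φ.symm y) (coordVec φ j y)) : EuclideanSpace ℝ (Fin n))
      = fderiv ℝ (fun z => ψ (u (φ.symm z))) y (EuclideanSpace.single j 1) := by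
  have h1 := (hφ.mdifferentiableAt_symm hy).hasMFDerivAt
  have h2 := (hu (φ.symm y)).hasMFDerivAt
  have h3 := (hψ.mdifferentiableAt huy).hasMFDerivAt
  have h := (h3.comp y (h2.comp y h1)).mfderiv
  rw [mfderiv_eq_fderiv] at h
  exact (congrArg (· (EuclideanSpace.single j 1)) h).symm

theorem contDiffAt_chart_comp {n : ℕ} {L M : Type*}
    [TopologicalSpace L] [ChartedSpace (EuclideanSpace ℝ (Fin k)) L] 
    [TopologicalSpace M] [ChartedSpace (EuclideanSpace ℝ (Fin n)) M] 
    {φ : OpenPartialHomeomorph L (EuclideanSpace ℝ (Fin k))}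
    {ψ : OpenPartialHomeomorph M (EuclideanSpace ℝ (Fin n))}
    (hφ : φ ∈ smoothCharts k L) (hψ : ψ ∈ smoothCharts n M)
    {u : L → M} (hu : ContMDiff (𝓡 k) (𝓡 n) ∞ u) {y : EuclideanSpace ℝ (Fin k)}
    (hy : y ∈ φ.target) (huy : u (φ.symm y) ∈ ψ.source) :
    ContDiffAt ℝ ∞ (fun z => ψ (u (φ.symm z))) y :=
  ((contMDiffAt_of_mem_maximalAtlas hψ huy).comp y
    (hu.contMDiffAt.comp y (contMDiffAt_symm_of_mem_maximalAtlas hφ hy))).contDiffAt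

end Frames

/-! ### First-order consequences of equality in the calibration inequality -/

/-- The Gram matrix of vectors of `ℝⁿ` for the bilinear form with matrix `H`. -/
def coordGram {k n : ℕ} (H : Matrix (Fin n) (Fin n) ℝ) (v : Fin k → EuclideanSpace ℝ (Fin n)) :
    Matrix (Fin k) (Fin k) ℝ :=
  Matrix.of fun i j => ∑ a, ∑ b, H a b * v i a * v j b

/-- Jacobi's formula: the determinant is multilinear in the rows, and the determinant with one row
replaced is given by Cramer's rule, hence by the adjugate. -/
theorem hasDerivAt_det {k : ℕ} {G : ℝ → Matrix (Fin k) (Fin k) ℝ} {G' : Matrix (Fin k) (Fin k) ℝ}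
    {t : ℝ} (h : ∀ i j, HasDerivAt (fun s => G s i j) (G' i j) t) :
    HasDerivAt (fun s => (G s).det) (((G t).adjugate * G').trace) t := by
  let f : ContinuousMultilinearMap ℝ (fun _ : Fin k => Fin k → ℝ) ℝ :=
    { (Matrix.detRowAlternating : (Fin k → ℝ) [⋀^Fin k]→ₗ[ℝ] ℝ).toMultilinearMap with
      cont := Continuous.matrix_det (A := fun M : Fin k → Fin k → ℝ => M) continuous_id }
  have hG : HasDerivAt (fun s => (G s : Fin k → Fin k → ℝ)) G' t :=
    hasDerivAt_pi.2 fun i => hasDerivAt_pi.2 fun j => h i j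
  have := (f.hasFDerivAt (G t)).comp_hasDerivAt t hG
  refine this.congr_deriv ?_
  refine (ContinuousMultilinearMap.linearDeriv_apply f (G t) G').trans ?_
  rw [Matrix.trace_mul_comm]
  simp only [Matrix.trace, Matrix.diag, Matrix.mul_apply]
  refine Finset.sum_congr rfl fun i _ => ?_
  change (Matrix.updateRow (G t) i (G' i)).det = _
  rw [← Matrix.cramer_transpose_apply, Matrix.cramer_eq_adjugate_mulVec,
    ← Matrix.adjugate_transpose]
  simp [Matrix.mulVec, dotProduct, mul_comm]

/-- The difference `det G - f²` has a local minimum at a point of equality, so its derivative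
vanishes there. -/
theorem two_mul_deriv_eq_trace_of_sq_le_det {k : ℕ} {G : ℝ → Matrix (Fin k) (Fin k) ℝ}
    {G' : Matrix (Fin k) (Fin k) ℝ} {f : ℝ → ℝ} {f' t : ℝ}
    (hG : ∀ i j, HasDerivAt (fun s => G s i j) (G' i j) t) (hf : HasDerivAt f f' t)
    (hle : ∀ᶠ s in 𝓝 t, f s ^ 2 ≤ (G s).det) (heq : f t ^ 2 = (G t).det) :
    2 * f t * f' = ((G t).adjugate * G').trace := by
  have hmin : IsLocalMin (fun s => (G s).det - f s ^ 2) t := by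
    filter_upwards [hle] with s hs
    rw [heq, sub_self]
    exact sub_nonneg.2 hs
  have := hmin.hasDerivAt_eq_zero ((hasDerivAt_det hG).sub (hf.pow 2))
  simp at this
  linarith

/-- First-order consequence of equality in `f² ≤ det G` at a point where `G = λ² g`. -/
theorem conformal_deriv_eq {m : ℕ} {G : ℝ → Matrix (Fin (m + 2)) (Fin (m + 2)) ℝ}
    {G' g : Matrix (Fin (m + 2)) (Fin (m + 2)) ℝ} {f : ℝ → ℝ} {f' t l ε : ℝ}
    (hG : ∀ i j, HasDerivAt (fun s => G s i j) (G' i j) t) (hf : HasDerivAt f f' t)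
    (hle : ∀ᶠ s in 𝓝 t, f s ^ 2 ≤ (G s).det) (hg : g.PosDef) (hl : 0 < l) (hε : ε ^ 2 = 1)
    (hGg : G t = l ^ 2 • g) (hft : f t = l ^ (m + 2) * (ε * √g.det)) :
    2 * (ε * f') = l ^ m * √g.det * (g⁻¹ * G').trace := by
  have hd := hg.det_pos
  have hs : 0 < √g.det := Real.sqrt_pos.2 hd
  have hs2 : √g.det ^ 2 = g.det := Real.sq_sqrt hd.le
  have heq : f t ^ 2 = (G t).det := by
    rw [hft, hGg, Matrix.det_smul, Fintype.card_fin]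
    linear_combination (l ^ (m + 2)) ^ 2 * √g.det ^ 2 * hε + (l ^ (m + 2)) ^ 2 * hs2
  have h := two_mul_deriv_eq_trace_of_sq_le_det hG hf hle heq
  have hadj : g.adjugate = g.det • g⁻¹ := by
    rw [Matrix.inv_def, smul_smul, Ring.mul_inverse_cancel _ (isUnit_iff_ne_zero.2 hd.ne'),
      one_smul]
  rw [hGg, Matrix.adjugate_smul, hadj, hft, Fintype.card_fin, Matrix.smul_mul, Matrix.smul_mul,
    Matrix.trace_smul, Matrix.trace_smul, smul_eq_mul, smul_eq_mul] at h
  -- The adjugate of `l² g` carries `(l²)^(m+1) = l^(m+2) * l^m`, so cancelling the factor `l^(m+2)`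
  -- of `f t` leaves `l^m`.
  have hne : l ^ (m + 2) * √g.det ≠ 0 := by positivity
  refine mul_left_cancel₀ hne ?_
  rw [show m + 2 - 1 = m + 1 by omega] at h
  linear_combination h - (l ^ 2) ^ (m + 1) * (g⁻¹ * G').trace * hs2

theorem posSemidef_coordGram {k n : ℕ} {H : Matrix (Fin n) (Fin n) ℝ} (hH : H.PosDef)
    (v : Fin k → EuclideanSpace ℝ (Fin n)) : (coordGram H v).PosSemidef := by
  convert hH.posSemidef.mul_mul_conjTranspose_same (Matrix.of fun i a => v i a) using 1
  ext i j
  simp only [coordGram, Matrix.of_apply, Matrix.mul_apply, Matrix.conjTranspose_apply,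
    star_trivial, Finset.sum_mul]
  rw [Finset.sum_comm]
  refine Finset.sum_congr rfl fun a _ => Finset.sum_congr rfl fun b _ => by ring

/-- Swapping two vectors changes the sign of `β` but not the Gram determinant, so the one-sided
bound also bounds `-β`. This needs two distinct slots, which the degree `m + 2` provides. -/
theorem sq_le_det_coordGram {m n : ℕ} {H : Matrix (Fin n) (Fin n) ℝ} (hH : H.PosDef)
    {β : EuclideanSpace ℝ (Fin n) [⋀^Fin (m + 2)]→L[ℝ] ℝ}
    (hβ : ∀ v, β v ≤ √(coordGram H v).det) (v : Fin (m + 2) → EuclideanSpace ℝ (Fin n)) :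
    β v ^ 2 ≤ (coordGram H v).det := by
  have h0 := (posSemidef_coordGram hH v).det_nonneg
  have h1 := hβ v
  have h2 := hβ (v ∘ Equiv.swap 0 1)
  have h3 : β (v ∘ Equiv.swap 0 1) = - β v := β.toAlternatingMap.map_swap v (by simp)
  have h4 : coordGram H (v ∘ Equiv.swap 0 1)
      = (coordGram H v).submatrix (Equiv.swap 0 1) (Equiv.swap 0 1) := rfl
  rw [h3, h4, Matrix.det_submatrix_equiv_self] at h2
  rw [← Real.sq_sqrt h0]
  exact sq_le_sq' (by linarith) h1

theorem eq_zero_of_coordGram_self_eq_zero {k n : ℕ} {H : Matrix (Fin n) (Fin n) ℝ} (hH : H.PosDef)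
    {v : Fin k → EuclideanSpace ℝ (Fin n)} (i : Fin k) (h : coordGram H v i i = 0) : v i = 0 := by
  by_contra hv
  have h1 : (fun a => v i a) ≠ 0 := fun h => hv (by ext a; exact congrFun h a)
  have h2 := hH.dotProduct_mulVec_pos h1
  refine h2.ne' (h.symm.trans ?_).symm
  simp only [coordGram, Matrix.of_apply, dotProduct, Matrix.mulVec, Finset.mul_sum]
  refine Finset.sum_congr rfl fun a _ => Finset.sum_congr rfl fun b _ => by simp; ring

theorem eq_zero_of_coordGram_eq {k n : ℕ} {H : Matrix (Fin n) (Fin n) ℝ} (hH : H.PosDef)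
    {v : Fin k → EuclideanSpace ℝ (Fin n)} {g : Matrix (Fin k) (Fin k) ℝ}
    (h : coordGram H v = (0 : ℝ) ^ 2 • g) : v = 0 :=
  funext fun i => eq_zero_of_coordGram_self_eq_zero hH i (by simp [h])

/-- The first cousin principle. -/
theorem apply_update_eq_of_calibrated {m n : ℕ} {H : Matrix (Fin n) (Fin n) ℝ} (hH : H.PosDef)
    {β : EuclideanSpace ℝ (Fin n) [⋀^Fin (m + 2)]→L[ℝ] ℝ}
    (hβ : ∀ v, β v ≤ √(coordGram H v).det) {g : Matrix (Fin (m + 2)) (Fin (m + 2)) ℝ}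
    (hg : g.PosDef) {v : Fin (m + 2) → EuclideanSpace ℝ (Fin n)} {l ε : ℝ} (hl : 0 ≤ l)
    (hε : ε ^ 2 = 1) (hG : coordGram H v = l ^ 2 • g)
    (hβv : β v = l ^ (m + 2) * (ε * √g.det)) (j : Fin (m + 2)) (w : EuclideanSpace ℝ (Fin n)) :
    ε * β (Function.update v j w)
      = l ^ m * √g.det * ∑ q, g⁻¹ j q * ∑ a, ∑ b, H a b * w a * v q b := by
  -- If `l = 0`, all `v_i` vanish. A slot other than `j` then still holds zero, so the left side is
  -- zero; the right side is zero through `v q`, even for `m = 0`.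
  rcases hl.eq_or_lt with rfl | hl
  · obtain rfl := eq_zero_of_coordGram_eq hH hG
    obtain ⟨i, hi⟩ := exists_ne j
    rw [β.map_coord_zero i (by simp [hi])]
    simp
  -- Moving only slot `j` makes `β` affine in `t`, with slope the left side of the claim.
  let V : ℝ → Fin (m + 2) → EuclideanSpace ℝ (Fin n) :=
    fun t => Function.update v j (v j + t • w)
  have hV0 : V 0 = v := by simp [V]
  have hf : HasDerivAt (fun t => β (V t)) (β (Function.update v j w)) 0 := by
    have : (fun t => β (V t)) = fun t => β v + t * β (Function.update v j w) := by
      funext t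
      simp [V, β.map_update_add, β.map_update_smul]
    rw [this]
    simpa using ((hasDerivAt_id (0 : ℝ)).mul_const (β (Function.update v j w))).const_add (β v)
  have hVd : ∀ i a, HasDerivAt (fun t => V t i a) (if i = j then w a else 0) 0 := by
    intro i a
    by_cases h : i = j
    · subst h
      simpa [V] using ((hasDerivAt_id (0 : ℝ)).mul_const (w a)).const_add (v i a)
    · simpa [V, h] using hasDerivAt_const (0 : ℝ) (v i a)
  let c : Fin (m + 2) → ℝ := fun q => ∑ a, ∑ b, H a b * w a * v q b
  have hGd : ∀ p q, HasDerivAt (fun t => coordGram H (V t) p q)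
      ((Matrix.of fun p q => (if p = j then c q else 0) + (if q = j then c p else 0)) p q) 0 := by
    intro p q
    simp only [coordGram, Matrix.of_apply]
    have h1 : HasDerivAt (fun t => ∑ a, ∑ b, H a b * V t p a * V t q b)
        (∑ a, ∑ b, (H a b * (if p = j then w a else 0) * V 0 q b
          + H a b * V 0 p a * (if q = j then w b else 0))) 0 :=
      HasDerivAt.fun_sum fun a _ => HasDerivAt.fun_sum fun b _ =>
        ((hVd p a).const_mul (H a b)).mul (hVd q b)
    refine h1.congr_deriv ?_
    rw [hV0]
    simp only [Finset.sum_add_distrib]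
    congr 1
    · split_ifs <;> simp [c]
    · split_ifs
      · rw [Finset.sum_comm]
        refine Finset.sum_congr rfl fun a _ => Finset.sum_congr rfl fun b _ => ?_
        rw [← hH.isHermitian.apply a b, star_trivial]; ring
      · simp
  have key := conformal_deriv_eq hGd hf
    (Filter.Eventually.of_forall fun t => sq_le_det_coordGram hH hβ (V t)) hg hl hε
    (by rw [hV0, hG]) (by simp only [hV0, hβv])
  have htr : (g⁻¹ * Matrix.of fun p q => (if p = j then c q else 0)
      + (if q = j then c p else 0)).trace = 2 * ∑ q, g⁻¹ j q * c q := by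
    simp only [Matrix.trace, Matrix.diag, Matrix.mul_apply, Matrix.of_apply, mul_add,
      Finset.sum_add_distrib, mul_ite, mul_zero, Finset.sum_ite_eq', Finset.mem_univ, if_true]
    rw [two_mul]
    congr 1
    · refine Finset.sum_congr rfl fun q _ => ?_
      rw [← hg.isHermitian.inv.apply j q, star_trivial]
    · rw [Finset.sum_comm]; simp
  rw [htr] at key
  change _ = l ^ m * √g.det * ∑ q, g⁻¹ j q * c q
  linarith

/-- The first variation, in the base point, of equality in the calibration inequality. -/
theorem fderiv_apply_eq_of_calibrated {m n : ℕ}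
    {H : EuclideanSpace ℝ (Fin n) → Matrix (Fin n) (Fin n) ℝ}
    {β : EuclideanSpace ℝ (Fin n) → EuclideanSpace ℝ (Fin n) [⋀^Fin (m + 2)]→L[ℝ] ℝ}
    {z : EuclideanSpace ℝ (Fin n)} (hHd : ∀ a b, DifferentiableAt ℝ (fun z => H z a b) z)
    (hβd : DifferentiableAt ℝ β z) (hH : ∀ᶠ z in 𝓝 z, (H z).PosDef)
    (hβ : ∀ᶠ z in 𝓝 z, ∀ v, β z v ≤ √(coordGram (H z) v).det)
    {g : Matrix (Fin (m + 2)) (Fin (m + 2)) ℝ}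
    (hg : g.PosDef) {v : Fin (m + 2) → EuclideanSpace ℝ (Fin n)} {l ε : ℝ} (hl : 0 ≤ l)
    (hε : ε ^ 2 = 1) (hG : coordGram (H z) v = l ^ 2 • g)
    (hβv : β z v = l ^ (m + 2) * (ε * √g.det)) (e : EuclideanSpace ℝ (Fin n)) :
    2 * (ε * fderiv ℝ β z e v) = l ^ m * √g.det *
      ∑ i, ∑ j, g⁻¹ i j * ∑ c, ∑ d, fderiv ℝ (fun z => H z c d) z e * v i c * v j d := by
  rcases hl.eq_or_lt with rfl | hl
  · obtain rfl := eq_zero_of_coordGram_eq hH.self_of_nhds hG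
    rw [(fderiv ℝ β z e).map_coord_zero 0 rfl]
    simp
  -- The vectors `v` stay fixed while the base point moves along a line: only `β` and `H` vary.
  have hline : HasDerivAt (fun t : ℝ => z + t • e) e 0 := by
    simpa using ((hasDerivAt_id (0 : ℝ)).smul_const e).const_add z
  have hz : z + (0 : ℝ) • e = z := by simp
  have hf : HasDerivAt (fun t : ℝ => β (z + t • e) v) (fderiv ℝ β z e v) 0 := by
    have h1 : HasFDerivAt β (fderiv ℝ β z) (z + (0 : ℝ) • e) := by rw [hz]; exact hβd.hasFDerivAt
    have h2 := (h1.comp_hasDerivAt (0 : ℝ) hline).hasFDerivAt.continuousAlternatingMap_apply_const v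
    simpa using h2.hasDerivAt
  have hGd : ∀ i j, HasDerivAt (fun t : ℝ => coordGram (H (z + t • e)) v i j)
      ((Matrix.of fun i j => ∑ c, ∑ d, fderiv ℝ (fun z => H z c d) z e * v i c * v j d) i j) 0 := by
    intro i j
    simp only [coordGram, Matrix.of_apply]
    refine HasDerivAt.fun_sum fun c _ => HasDerivAt.fun_sum fun d _ => ?_
    have h1 : HasFDerivAt (fun z => H z c d) (fderiv ℝ (fun z => H z c d) z) (z + (0 : ℝ) • e) := by
      rw [hz]; exact (hHd c d).hasFDerivAt
    exact ((h1.comp_hasDerivAt (0 : ℝ) hline).mul_const _).mul_const _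
  have hle : ∀ᶠ t : ℝ in 𝓝 0, β (z + t • e) v ^ 2 ≤ (coordGram (H (z + t • e)) v).det := by
    have ht : Filter.Tendsto (fun t : ℝ => z + t • e) (𝓝 0) (𝓝 z) := by
      simpa using hline.continuousAt.tendsto
    filter_upwards [ht.eventually hH, ht.eventually hβ] with t h1 h2
    exact sq_le_det_coordGram h1 h2 v
  have key := conformal_deriv_eq hGd hf hle hg hl hε (by rw [hz, hG]) (by simp only [hz, hβv])
  rw [key]
  congr 1
  rw [Matrix.trace_mul_comm]
  simp only [Matrix.trace, Matrix.diag, Matrix.mul_apply, Matrix.of_apply]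
  refine Finset.sum_congr rfl fun i _ => Finset.sum_congr rfl fun j _ => ?_
  rw [← hg.isHermitian.inv.apply i j, star_trivial, mul_comm]

/-! ### Closedness and the divergence of the contracted form -/

/-- `dβ = 0` evaluated on `w, v₁, …, v_k`. -/
theorem sum_fderiv_update_of_extDeriv_eq_zero {m : ℕ} {E : Type*} [NormedAddCommGroup E]
    [NormedSpace ℝ E] {β : E → E [⋀^Fin (m + 1)]→L[ℝ] ℝ} {z : E} (h : extDeriv β z = 0)
    (v : Fin (m + 1) → E) (w : E) :
    ∑ j, fderiv ℝ β z (v j) (Function.update v j w) = fderiv ℝ β z w v := by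
  have h1 : extDeriv β z (Fin.cons w v) = 0 := by rw [h]; rfl
  rw [extDeriv, ContinuousAlternatingMap.alternatizeUncurryFin_apply, Fin.sum_univ_succ] at h1
  simp only [Fin.cons_zero, Fin.cons_succ, Fin.val_zero, pow_zero, one_smul,
    Fin.removeNth_zero, Fin.tail_cons, Fin.val_succ] at h1
  -- Carrying `w` from the front to slot `j` costs `(-1)^j`; against the sign `(-1)^(j+1)` of the
  -- exterior derivative this leaves `-1` for every `j`.
  have h2 : ∀ j : Fin (m + 1), (-1 : ℤ) ^ ((j : ℕ) + 1) •
      fderiv ℝ β z (v j) (Fin.removeNth j.succ (Fin.cons w v : Fin (m + 2) → E))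
      = - fderiv ℝ β z (v j) (Function.update v j w) := by
    intro j
    have h3 : (Fin.removeNth j.succ (Fin.cons w v : Fin (m + 2) → E))
        = Matrix.vecCons w (Fin.removeNth j v) := by
      funext i
      refine Fin.cases rfl (fun i => ?_) i
      simp [Fin.removeNth, Matrix.vecCons]
    rw [h3, ← Fin.insertNth_removeNth, ContinuousAlternatingMap.map_insertNth, pow_succ]
    simp
  have h4 := Finset.sum_congr rfl fun j (_ : j ∈ Finset.univ) => h2 j
  rw [Finset.sum_neg_distrib] at h4
  linarith

/-- Exchanging `i` and `j` transposes two arguments of `β`, while `S` is symmetric, so the terms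
cancel in pairs. In the application `S` is the Hessian of `U`; the diagonal entry is zero because
slot `j` holds the constant vector `w`. -/
theorem sum_apply_update_update_eq_zero {k : ℕ} {E : Type*} [AddCommGroup E]
    [Module ℝ E] [TopologicalSpace E] (β : E [⋀^Fin k]→L[ℝ] ℝ) (v : Fin k → E) (w : E)
    (S : Fin k → Fin k → E) (hS : ∀ i j, S i j = S j i) :
    ∑ j, ∑ i, β (Function.update (Function.update v j w) i (if i = j then 0 else S i j)) = 0 := by
  have h : ∀ i j, β (Function.update (Function.update v j w) i (if i = j then 0 else S i j))
      = - β (Function.update (Function.update v i w) j (if j = i then 0 else S j i)) := by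
    intro i j
    by_cases hij : i = j
    · subst hij
      simp [β.map_update_zero]
    · rw [if_neg hij, if_neg (Ne.symm hij), ← ContinuousAlternatingMap.coe_toAlternatingMap,
        ← β.toAlternatingMap.map_swap _ hij, hS j i]
      congr 1
      funext q
      by_cases h1 : q = i
      · subst h1; simp
      · by_cases h2 : q = j
        · subst h2; simp [hij, Function.update_of_ne h1]
        · simp [h1, h2, Equiv.swap_apply_of_ne_of_ne h1 h2]
  have h2 := Finset.sum_comm (s := Finset.univ) (t := Finset.univ) (f := fun i j =>
    β (Function.update (Function.update v j w) i (if i = j then 0 else S i j)))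
  have h3 : ∑ i, ∑ j, β (Function.update (Function.update v j w) i (if i = j then 0 else S i j))
      = - ∑ i, ∑ j, β (Function.update (Function.update v i w) j (if j = i then 0 else S j i)) := by
    simp_rw [← Finset.sum_neg_distrib]
    exact Finset.sum_congr rfl fun i _ => Finset.sum_congr rfl fun j _ => h i j
  linarith

/-- The product rule yields derivatives of `β` along `v_j`, which closedness sums up, and second
derivatives of `U`, which cancel by their symmetry. -/
theorem sum_fderiv_apply_update {m n : ℕ}
    {U : EuclideanSpace ℝ (Fin (m + 1)) → EuclideanSpace ℝ (Fin n)}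
    {β : EuclideanSpace ℝ (Fin n) → EuclideanSpace ℝ (Fin n) [⋀^Fin (m + 1)]→L[ℝ] ℝ}
    {y : EuclideanSpace ℝ (Fin (m + 1))} (hU : ContDiffAt ℝ 2 U y)
    (hβ : DifferentiableAt ℝ β (U y)) (hd : extDeriv β (U y) = 0)
    (w : EuclideanSpace ℝ (Fin n)) :
    (∀ j, DifferentiableAt ℝ (fun y => β (U y) (Function.update
      (fun i => fderiv ℝ U y (EuclideanSpace.single i 1)) j w)) y) ∧
    ∑ j, fderiv ℝ (fun y => β (U y) (Function.update
      (fun i => fderiv ℝ U y (EuclideanSpace.single i 1)) j w)) y (EuclideanSpace.single j 1)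
      = fderiv ℝ β (U y) w (fun i => fderiv ℝ U y (EuclideanSpace.single i 1)) := by
  have hUd := hU.differentiableAt two_ne_zero
  have hU' : DifferentiableAt ℝ (fderiv ℝ U) y :=
    (hU.fderiv_right (m := 1) le_rfl).differentiableAt one_ne_zero
  have hUi : ∀ e, DifferentiableAt ℝ (fun y => fderiv ℝ U y e) y := fun e =>
    hU'.clm_apply (differentiableAt_const e)
  have hg : ∀ j i, DifferentiableAt ℝ (fun y => Function.update
      (fun i => fderiv ℝ U y (EuclideanSpace.single i 1)) j w i) y := by
    intro j i
    by_cases h : i = j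
    · subst h; simp
    · simpa [h] using hUi _
  have hβU : DifferentiableAt ℝ (fun y => β (U y)) y := hβ.comp y hUd
  refine ⟨fun j => hβU.continuousAlternatingMap_apply (hg j), ?_⟩
  have h1 : ∀ j, fderiv ℝ (fun y => β (U y) (Function.update
      (fun i => fderiv ℝ U y (EuclideanSpace.single i 1)) j w)) y (EuclideanSpace.single j 1)
      = fderiv ℝ β (U y) (fderiv ℝ U y (EuclideanSpace.single j 1)) (Function.update
        (fun i => fderiv ℝ U y (EuclideanSpace.single i 1)) j w)
      + ∑ i, β (U y) (Function.update (Function.update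
        (fun i => fderiv ℝ U y (EuclideanSpace.single i 1)) j w) i (if i = j then 0 else
          fderiv ℝ (fderiv ℝ U) y (EuclideanSpace.single j 1) (EuclideanSpace.single i 1))) := by
    intro j
    have := fderiv_continuousAlternatingMap_apply_apply hβU (hg j) (EuclideanSpace.single j 1)
    rw [this]
    congr 1
    · rw [show (fun y => β (U y)) = β ∘ U from rfl, fderiv_comp y hβ hUd]
      rfl
    · refine Finset.sum_congr rfl fun i _ => ?_
      congr 2
      split_ifs with h
      · subst h; simp
      · simp only [Function.update_of_ne h]
        rw [fderiv_clm_apply hU' (differentiableAt_const _)]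
        simp
  simp_rw [h1]
  rw [Finset.sum_add_distrib, sum_apply_update_update_eq_zero (β (U y)) _ w
    (fun i j => fderiv ℝ (fderiv ℝ U) y (EuclideanSpace.single j 1) (EuclideanSpace.single i 1)),
    add_zero]
  · exact sum_fderiv_update_of_extDeriv_eq_zero hd
      (fun i => fderiv ℝ U y (EuclideanSpace.single i 1)) w
  · intro i j
    exact hU.isSymmSndFDerivAt (by simp) _ _

/-! ### Divergences in coordinates -/

section Algebra

variable {k n : ℕ}

/-- The Christoffel symbols of a metric with inverse matrix `gi` and derivatives `dg`. -/
noncomputable def christoffelSum (gi : Matrix (Fin k) (Fin k) ℝ) (dg : Fin k → Fin k → Fin k → ℝ)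
    (l i j : Fin k) : ℝ :=
  (1 / 2) * ∑ r, gi l r * (dg i j r + dg j i r - dg r i j)

/-- The classical formula `√g · Div P = ∂_l(√g g^{li} P_i)`, reduced to algebra on values and
derivatives at one point: `s` plays `√det g`, and `hds` is Jacobi's formula. The hypothesis `hd`
differentiates `s P_i = g_{ij} W^j`, so the inverse metric never has to be differentiated. -/
theorem divergence_covector {g gi : Matrix (Fin k) (Fin k) ℝ} (hgi : gi * g = 1)
    (hsymm : ∀ i j, gi i j = gi j i) {dg : Fin k → Fin k → Fin k → ℝ} {s : ℝ}
    {ds P W : Fin k → ℝ} {dP dW : Fin k → Fin k → ℝ}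
    (hds : ∀ l, ds l = 1 / 2 * s * ∑ p, ∑ q, gi p q * dg l p q)
    (hW : ∀ j, W j = s * ∑ i, gi j i * P i)
    (hd : ∀ l i, ds l * P i + s * dP l i = ∑ j, dg l i j * W j + ∑ j, g i j * dW l j) :
    s * ∑ i, ∑ j, gi i j * (dP i j - ∑ l, christoffelSum gi dg l i j * P l) = ∑ l, dW l l := by
  have e1 : ∑ i, ∑ j, gi i j * ∑ r, g j r * dW i r = ∑ l, dW l l := by
    refine Finset.sum_congr rfl fun i _ => ?_
    simp_rw [Finset.mul_sum]
    rw [Finset.sum_comm]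
    have : ∀ r, ∑ j, gi i j * (g j r * dW i r) = (gi * g) i r * dW i r := fun r => by
      rw [Matrix.mul_apply, Finset.sum_mul]
      exact Finset.sum_congr rfl fun j _ => by ring
    simp_rw [this, hgi, Matrix.one_apply]
    simp
  have e3 : ∑ i, ∑ j, gi i j * (ds i * P j) = ∑ r, (1 / 2 * ∑ p, ∑ q, gi p q * dg r p q) * W r := by
    refine Finset.sum_congr rfl fun i _ => ?_
    rw [hW, hds]
    generalize ∑ p, ∑ q, gi p q * dg i p q = Q
    simp_rw [Finset.mul_sum]
    exact Finset.sum_congr rfl fun j _ => by ring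
  have e4 : ∀ i j, s * ∑ l, christoffelSum gi dg l i j * P l
      = ∑ r, 1 / 2 * (dg i j r + dg j i r - dg r i j) * W r := by
    intro i j
    simp_rw [hW, christoffelSum, Finset.mul_sum, Finset.sum_mul, Finset.mul_sum]
    rw [Finset.sum_comm]
    refine Finset.sum_congr rfl fun r _ => Finset.sum_congr rfl fun l _ => ?_
    rw [hsymm r l]; ring
  -- Symmetry of `gi` identifies the first two Christoffel terms; the third is the logarithmic
  -- derivative of `s` and cancels against `e3`.
  have e5 : ∑ i, ∑ j, gi i j * ∑ r, 1 / 2 * (dg i j r + dg j i r - dg r i j) * W r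
      = ∑ i, ∑ j, gi i j * ∑ r, dg i j r * W r
        - ∑ r, (1 / 2 * ∑ p, ∑ q, gi p q * dg r p q) * W r := by
    have a1 : ∑ i, ∑ j, gi i j * ∑ r, dg j i r * W r = ∑ i, ∑ j, gi i j * ∑ r, dg i j r * W r := by
      rw [Finset.sum_comm]
      exact Finset.sum_congr rfl fun i _ => Finset.sum_congr rfl fun j _ => by rw [hsymm]
    have a2 : ∑ i, ∑ j, gi i j * ∑ r, dg r i j * W r
        = ∑ r, (∑ p, ∑ q, gi p q * dg r p q) * W r := by
      simp_rw [Finset.sum_mul, Finset.mul_sum]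
      rw [Finset.sum_comm_cycle]
      exact Finset.sum_congr rfl fun i _ => Finset.sum_congr rfl fun j _ =>
        Finset.sum_congr rfl fun l _ => by ring
    have a3 : ∀ i j, gi i j * ∑ r, 1 / 2 * (dg i j r + dg j i r - dg r i j) * W r
        = 1 / 2 * (gi i j * ∑ r, dg i j r * W r) + 1 / 2 * (gi i j * ∑ r, dg j i r * W r)
          - 1 / 2 * (gi i j * ∑ r, dg r i j * W r) := by
      intro i j
      simp_rw [Finset.mul_sum]
      rw [← Finset.sum_add_distrib, ← Finset.sum_sub_distrib]
      exact Finset.sum_congr rfl fun r _ => by ring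
    simp_rw [a3, Finset.sum_sub_distrib, Finset.sum_add_distrib, ← Finset.mul_sum]
    rw [a1, a2]
    simp_rw [mul_assoc (1 / 2 : ℝ)]
    rw [← Finset.mul_sum]
    ring
  have e6 : ∀ i j, s * (gi i j * (dP i j - ∑ l, christoffelSum gi dg l i j * P l))
      = gi i j * ∑ r, dg i j r * W r + gi i j * ∑ r, g j r * dW i r - gi i j * (ds i * P j)
        - gi i j * ∑ r, 1 / 2 * (dg i j r + dg j i r - dg r i j) * W r := by
    intro i j
    rw [← e4]
    linear_combination gi i j * hd i j
  rw [Finset.mul_sum]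
  simp_rw [Finset.mul_sum _ _ s, e6, Finset.sum_sub_distrib, Finset.sum_add_distrib]
  rw [e1, e3, e5]
  ring

theorem sum_mul_christoffelSum {h hi : Matrix (Fin n) (Fin n) ℝ} (hhi : h * hi = 1)
    (hsymm : ∀ a b, h a b = h b a) (dh : Fin n → Fin n → Fin n → ℝ) (b c d : Fin n) :
    ∑ a, h a b * christoffelSum hi dh a c d = 1 / 2 * (dh c d b + dh d c b - dh b c d) := by
  simp_rw [christoffelSum, Finset.mul_sum]
  rw [Finset.sum_comm]
  have : ∀ r, ∑ a, h a b * (1 / 2 * (hi a r * (dh c d r + dh d c r - dh r c d)))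
      = (h * hi) b r * (1 / 2 * (dh c d r + dh d c r - dh r c d)) := fun r => by
    rw [Matrix.mul_apply, Finset.sum_mul]
    exact Finset.sum_congr rfl fun a _ => by rw [hsymm b a]; ring
  simp_rw [this, hhi, Matrix.one_apply]
  simp

/-- Since `F` is proportional to `u`, the contraction `g^{ij} u_i^c F_j^d` is symmetric in `c` and
`d`. Of the lowered Christoffel symbols, the first two terms then combine into the derivative of `h`
along the map, which completes the product rule for `h_{ab} F^a`; only `-½ ∂_b h_{cd}` remains. -/
theorem divergence_lower {gi : Matrix (Fin k) (Fin k) ℝ} (hsymm : ∀ i j, gi i j = gi j i)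
    (Γ : Fin k → Fin k → Fin k → ℝ) {h hi : Matrix (Fin n) (Fin n) ℝ} (hhi : h * hi = 1)
    (hhsymm : ∀ a b, h a b = h b a) {dh : Fin n → Fin n → Fin n → ℝ} {u F : Fin k → Fin n → ℝ}
    {σ : ℝ} (hF : ∀ i a, F i a = σ * u i a) (dF : Fin k → Fin k → Fin n → ℝ) (b : Fin n) :
    ∑ a, h a b * ∑ i, ∑ j, gi i j * (dF i j a - ∑ l, Γ l i j * F l a
        + ∑ c, ∑ d, christoffelSum hi dh a c d * u i c * F j d)
      = ∑ i, ∑ j, gi i j * ((∑ a, (∑ c, dh c a b * u i c) * F j a + ∑ a, h a b * dF i j a)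
          - ∑ l, Γ l i j * ∑ a, h a b * F l a)
        - 1 / 2 * ∑ i, ∑ j, gi i j * ∑ c, ∑ d, dh b c d * u i c * F j d := by
  have e1 : ∀ i j, ∑ a, h a b * ∑ c, ∑ d, christoffelSum hi dh a c d * u i c * F j d
      = ∑ c, ∑ d, 1 / 2 * (dh c d b + dh d c b - dh b c d) * (u i c * F j d) := by
    intro i j
    simp_rw [← sum_mul_christoffelSum hhi hhsymm, Finset.mul_sum, Finset.sum_mul]
    rw [Finset.sum_comm]
    refine Finset.sum_congr rfl fun c _ => ?_
    rw [Finset.sum_comm]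
    exact Finset.sum_congr rfl fun d _ => Finset.sum_congr rfl fun a _ => by ring
  have e2 : ∑ i, ∑ j, gi i j * ∑ c, ∑ d, dh d c b * (u i c * F j d)
      = ∑ i, ∑ j, gi i j * ∑ c, ∑ d, dh c d b * (u i c * F j d) := by
    rw [Finset.sum_comm]
    refine Finset.sum_congr rfl fun i _ => Finset.sum_congr rfl fun j _ => ?_
    rw [hsymm j i, Finset.sum_comm]
    congr 1
    refine Finset.sum_congr rfl fun c _ => Finset.sum_congr rfl fun d _ => ?_
    rw [hF, hF]; ring
  have e3 : ∀ i j, ∑ a, (∑ c, dh c a b * u i c) * F j a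
      = ∑ c, ∑ d, dh c d b * (u i c * F j d) := by
    intro i j
    simp_rw [Finset.sum_mul]
    rw [Finset.sum_comm]
    exact Finset.sum_congr rfl fun c _ => Finset.sum_congr rfl fun d _ => by ring
  have e4 : ∀ i j, ∑ a, h a b * ∑ l, Γ l i j * F l a = ∑ l, Γ l i j * ∑ a, h a b * F l a := by
    intro i j
    simp_rw [Finset.mul_sum]
    rw [Finset.sum_comm]
    exact Finset.sum_congr rfl fun c _ => Finset.sum_congr rfl fun d _ => by ring
  have e5 : ∀ i j, ∑ c, ∑ d, 1 / 2 * (dh c d b + dh d c b - dh b c d) * (u i c * F j d)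
      = 1 / 2 * (∑ c, ∑ d, dh c d b * (u i c * F j d))
        + 1 / 2 * (∑ c, ∑ d, dh d c b * (u i c * F j d))
        - 1 / 2 * ∑ c, ∑ d, dh b c d * u i c * F j d := by
    intro i j
    simp_rw [Finset.mul_sum, ← Finset.sum_add_distrib, ← Finset.sum_sub_distrib]
    exact Finset.sum_congr rfl fun c _ => Finset.sum_congr rfl fun d _ => by ring
  have e6 : ∑ a, h a b * ∑ i, ∑ j, gi i j * (dF i j a - ∑ l, Γ l i j * F l a
        + ∑ c, ∑ d, christoffelSum hi dh a c d * u i c * F j d)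
      = ∑ i, ∑ j, gi i j * (∑ a, h a b * dF i j a - ∑ a, h a b * ∑ l, Γ l i j * F l a
        + ∑ a, h a b * ∑ c, ∑ d, christoffelSum hi dh a c d * u i c * F j d) := by
    simp_rw [← Finset.sum_sub_distrib, ← Finset.sum_add_distrib]
    simp_rw [fun a => Finset.mul_sum Finset.univ (fun i => ∑ j, gi i j *
        (dF i j a - ∑ l, Γ l i j * F l a
        + ∑ c, ∑ d, christoffelSum hi dh a c d * u i c * F j d)) (h a b)]
    rw [Finset.sum_comm]
    refine Finset.sum_congr rfl fun i _ => ?_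
    simp_rw [fun a => Finset.mul_sum Finset.univ (fun j => gi i j *
        (dF i j a - ∑ l, Γ l i j * F l a
        + ∑ c, ∑ d, christoffelSum hi dh a c d * u i c * F j d)) (h a b)]
    rw [Finset.sum_comm]
    refine Finset.sum_congr rfl fun j _ => ?_
    rw [Finset.mul_sum]
    exact Finset.sum_congr rfl fun a _ => by ring
  have e7 : ∀ i j, gi i j * (∑ a, h a b * dF i j a - ∑ l, Γ l i j * ∑ a, h a b * F l a
        + (1 / 2 * (∑ c, ∑ d, dh c d b * (u i c * F j d))
          + 1 / 2 * (∑ c, ∑ d, dh d c b * (u i c * F j d))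
          - 1 / 2 * ∑ c, ∑ d, dh b c d * u i c * F j d))
      = gi i j * ((∑ c, ∑ d, dh c d b * (u i c * F j d) + ∑ a, h a b * dF i j a)
          - ∑ l, Γ l i j * ∑ a, h a b * F l a)
        + 1 / 2 * (gi i j * ∑ c, ∑ d, dh d c b * (u i c * F j d))
        - 1 / 2 * (gi i j * ∑ c, ∑ d, dh c d b * (u i c * F j d))
        - 1 / 2 * (gi i j * ∑ c, ∑ d, dh b c d * u i c * F j d) := by
    intro i j; ring
  rw [e6]
  simp_rw [e1, e3, e4, e5, e7, Finset.sum_sub_distrib, Finset.sum_add_distrib,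
    ← Finset.mul_sum Finset.univ _ (1 / 2 : ℝ)]
  rw [e2]
  ring

/-- A divergence vanishes when its density, with the upper index lowered, has the right
coordinate divergence. -/
theorem divergence_eq_zero {g gi : Matrix (Fin k) (Fin k) ℝ} (hgi : gi * g = 1)
    (hsymm : ∀ i j, gi i j = gi j i) {dg : Fin k → Fin k → Fin k → ℝ} {s : ℝ} (hs : s ≠ 0)
    {ds : Fin k → ℝ} (hds : ∀ l, ds l = 1 / 2 * s * ∑ p, ∑ q, gi p q * dg l p q)
    {h hi : Matrix (Fin n) (Fin n) ℝ} (hhi : h * hi = 1)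
    (hhsymm : ∀ a b, h a b = h b a) {dh : Fin n → Fin n → Fin n → ℝ} {u F : Fin k → Fin n → ℝ}
    {σ : ℝ} (hF : ∀ i a, F i a = σ * u i a) {dF : Fin k → Fin k → Fin n → ℝ}
    {W : Fin n → Fin k → ℝ} {dW : Fin n → Fin k → Fin k → ℝ}
    (hW : ∀ b j, W b j = s * ∑ i, gi j i * ∑ a, h a b * F i a)
    (hd : ∀ b l i, ds l * (∑ a, h a b * F i a)
      + s * (∑ a, (∑ c, dh c a b * u l c) * F i a + ∑ a, h a b * dF l i a)
        = ∑ j, dg l i j * W b j + ∑ j, g i j * dW b l j)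
    (hdiv : ∀ b, ∑ l, dW b l l
      = 1 / 2 * s * ∑ i, ∑ j, gi i j * ∑ c, ∑ d, dh b c d * u i c * F j d) (a : Fin n) :
    ∑ i, ∑ j, gi i j * (dF i j a - ∑ l, christoffelSum gi dg l i j * F l a
        + ∑ c, ∑ d, christoffelSum hi dh a c d * u i c * F j d) = 0 := by
  let D : Fin n → ℝ := fun a => ∑ i, ∑ j, gi i j * (dF i j a
    - ∑ l, christoffelSum gi dg l i j * F l a
    + ∑ c, ∑ d, christoffelSum hi dh a c d * u i c * F j d)
  -- It suffices to annihilate the lowered components, `h` being invertible; there `hdiv` cancels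
  -- the remaining `∂_b h` term.
  have hD : ∀ b, ∑ a, h a b * D a = 0 := by
    intro b
    have h1 := divergence_lower hsymm (christoffelSum gi dg) hhi hhsymm (dh := dh) hF dF b
    have h2 := divergence_covector hgi hsymm hds (hW b) (hd b)
    refine mul_left_cancel₀ hs ?_
    rw [h1, mul_sub, h2, hdiv]
    ring
  have h3 : h.mulVec D = 0 := by
    funext b
    refine Eq.trans ?_ (hD b)
    simp_rw [hhsymm _ b]
    rfl
  have h4 : (hi * h).mulVec D = 0 := by rw [← Matrix.mulVec_mulVec, h3, Matrix.mulVec_zero]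
  rw [mul_eq_one_comm.1 hhi, Matrix.one_mulVec] at h4
  exact congrFun h4 a

end Algebra


/-! ### Derivatives of determinants and inverses, and rules for `pderiv` -/

theorem differentiableAt_det {k : ℕ} {E : Type*} [NormedAddCommGroup E] [NormedSpace ℝ E]
    {A : E → Matrix (Fin k) (Fin k) ℝ} {y : E}
    (hA : ∀ i j, DifferentiableAt ℝ (fun z => A z i j) y) :
    DifferentiableAt ℝ (fun z => (A z).det) y := by
  simp only [Matrix.det_apply]
  fun_prop

theorem differentiableAt_inv_apply {k : ℕ} {E : Type*} [NormedAddCommGroup E] [NormedSpace ℝ E]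
    {A : E → Matrix (Fin k) (Fin k) ℝ} {y : E}
    (hA : ∀ i j, DifferentiableAt ℝ (fun z => A z i j) y) (hy : (A y).det ≠ 0) (i j : Fin k) :
    DifferentiableAt ℝ (fun z => (A z)⁻¹ i j) y := by
  simp only [Matrix.inv_def, Matrix.smul_apply, Ring.inverse_eq_inv', smul_eq_mul,
    Matrix.adjugate_apply]
  refine ((differentiableAt_det hA).inv hy).mul (differentiableAt_det fun p q => ?_)
  by_cases h : p = j
  · subst h; simp
  · simpa [h] using hA p q

theorem fderiv_sqrt_det {k : ℕ} {E : Type*} [NormedAddCommGroup E] [NormedSpace ℝ E]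
    {g : E → Matrix (Fin k) (Fin k) ℝ} {y : E}
    (hg : ∀ i j, DifferentiableAt ℝ (fun z => g z i j) y) (hpos : (g y).PosDef) (e : E) :
    fderiv ℝ (fun z => √(g z).det) y e
      = 1 / 2 * √(g y).det * ∑ p, ∑ q, (g y)⁻¹ p q * fderiv ℝ (fun z => g z p q) y e := by
  have hd := hpos.det_pos
  have hdet := differentiableAt_det hg
  rw [fderiv_sqrt hdet hd.ne']
  have hline : HasDerivAt (fun t : ℝ => y + t • e) e 0 := by
    simpa using ((hasDerivAt_id (0 : ℝ)).smul_const e).const_add y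
  have hz : y + (0 : ℝ) • e = y := by simp
  have h1 : HasDerivAt (fun t : ℝ => (g (y + t • e)).det)
      (fderiv ℝ (fun z => (g z).det) y e) 0 :=
    HasFDerivAt.comp_hasDerivAt (f := fun t : ℝ => y + t • e) (l := fun z => (g z).det) (0 : ℝ)
      (by rw [hz]; exact hdet.hasFDerivAt) hline
  have h2 := hasDerivAt_det (G := fun t : ℝ => g (y + t • e))
    (G' := Matrix.of fun i j => fderiv ℝ (fun z => g z i j) y e) (t := 0) fun i j =>
      HasFDerivAt.comp_hasDerivAt (f := fun t : ℝ => y + t • e) (l := fun z => g z i j) (0 : ℝ)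
        (by rw [hz]; exact (hg i j).hasFDerivAt) hline
  have h3 := h1.unique h2
  simp only [_root_.smul_apply, h3, hz, smul_eq_mul]
  have hadj : (g y).adjugate = (g y).det • (g y)⁻¹ := by
    rw [Matrix.inv_def, smul_smul, Ring.mul_inverse_cancel _ (isUnit_iff_ne_zero.2 hd.ne'),
      one_smul]
  rw [hadj, Matrix.smul_mul, Matrix.trace_smul, smul_eq_mul, Matrix.trace_mul_comm]
  have hT : (Matrix.of (fun i j => fderiv ℝ (fun z => g z i j) y e) * (g y)⁻¹).trace
      = ∑ p, ∑ q, (g y)⁻¹ p q * fderiv ℝ (fun z => g z p q) y e := by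
    simp only [Matrix.trace, Matrix.diag, Matrix.mul_apply, Matrix.of_apply]
    refine Finset.sum_congr rfl fun i _ => Finset.sum_congr rfl fun j _ => ?_
    rw [← hpos.isHermitian.inv.apply i j, star_trivial, mul_comm]
  rw [hT]
  have hs2 : √(g y).det ^ 2 = (g y).det := Real.sq_sqrt hd.le
  have hs := Real.sqrt_pos.2 hd
  field_simp
  rw [hs2]

theorem pderiv_apply {m n : ℕ} {U : EuclideanSpace ℝ (Fin m) → EuclideanSpace ℝ (Fin n)}
    {y : EuclideanSpace ℝ (Fin m)} (hU : DifferentiableAt ℝ U y) (i : Fin m) (a : Fin n) :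
    pderiv i (fun z => U z a) y = fderiv ℝ U y (EuclideanSpace.single i 1) a := by
  have := ((EuclideanSpace.proj a : EuclideanSpace ℝ (Fin n) →L[ℝ] ℝ).hasFDerivAt.comp y
    hU.hasFDerivAt).fderiv
  rw [pderiv]
  exact congrArg (· (EuclideanSpace.single i 1)) this

theorem pderiv_comp {m n : ℕ} {U : EuclideanSpace ℝ (Fin m) → EuclideanSpace ℝ (Fin n)}
    {y : EuclideanSpace ℝ (Fin m)} (hU : DifferentiableAt ℝ U y)
    {f : EuclideanSpace ℝ (Fin n) → ℝ} (hf : DifferentiableAt ℝ f (U y)) (i : Fin m) :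
    pderiv i (fun z => f (U z)) y
      = ∑ c, pderiv c f (U y) * fderiv ℝ U y (EuclideanSpace.single i 1) c := by
  rw [pderiv, show (fun z => f (U z)) = f ∘ U from rfl, fderiv_comp y hf hU]
  set w : EuclideanSpace ℝ (Fin n) := fderiv ℝ U y (EuclideanSpace.single i 1) with hw
  have h2 : ∑ a, w a • (EuclideanSpace.single a (1:ℝ) : EuclideanSpace ℝ (Fin n)) = w := by
    simpa using (EuclideanSpace.basisFun (Fin n) ℝ).sum_repr w
  change fderiv ℝ f (U y) w = _
  conv_lhs => rw [← h2, map_sum]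
  exact Finset.sum_congr rfl fun c _ => by rw [map_smul, smul_eq_mul, mul_comm]; rfl

section PDeriv

variable {m : ℕ} {i : Fin m} {y : EuclideanSpace ℝ (Fin m)} {f g : EuclideanSpace ℝ (Fin m) → ℝ}

theorem pderiv_congr (i : Fin m) (h : f =ᶠ[𝓝 y] g) : pderiv i f y = pderiv i g y := by
  rw [pderiv, h.fderiv_eq, pderiv]

theorem pderiv_mul (hf : DifferentiableAt ℝ f y) (hg : DifferentiableAt ℝ g y) :
    pderiv i (fun z => f z * g z) y = pderiv i f y * g y + f y * pderiv i g y := by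
  simp only [pderiv]
  rw [fderiv_fun_mul hf hg]
  simp only [_root_.add_apply, _root_.smul_apply, smul_eq_mul]
  ring

theorem pderiv_sum {ι : Type*} [Fintype ι] {f : ι → EuclideanSpace ℝ (Fin m) → ℝ}
    (hf : ∀ a, DifferentiableAt ℝ (f a) y) :
    pderiv i (fun z => ∑ a, f a z) y = ∑ a, pderiv i (f a) y := by
  simp only [pderiv]
  rw [fderiv_fun_sum fun a _ => hf a]
  simp

end PDeriv

/-! ### The theorem in coordinates -/

section Local

variable {m n : ℕ}
  {g : EuclideanSpace ℝ (Fin (m + 2)) → Matrix (Fin (m + 2)) (Fin (m + 2)) ℝ}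
  {H : EuclideanSpace ℝ (Fin n) → Matrix (Fin n) (Fin n) ℝ}
  {U : EuclideanSpace ℝ (Fin (m + 2)) → EuclideanSpace ℝ (Fin n)}
  {β : EuclideanSpace ℝ (Fin n) → EuclideanSpace ℝ (Fin n) [⋀^Fin (m + 2)]→L[ℝ] ℝ}
  {N : EuclideanSpace ℝ (Fin (m + 2)) → ℝ} {ε K : ℝ} {y : EuclideanSpace ℝ (Fin (m + 2))}

/-- The coordinate form of the theorem: `|du|^(k-2) du` is differentiable and divergence free. -/
theorem local_divergence
    (hg : ∀ i j, DifferentiableAt ℝ (fun z => g z i j) y) (hgp : ∀ᶠ z in 𝓝 y, (g z).PosDef)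
    (hH : ∀ a b, DifferentiableAt ℝ (fun z => H z a b) (U y))
    (hHp : ∀ᶠ z in 𝓝 (U y), (H z).PosDef) (hβd : DifferentiableAt ℝ β (U y))
    (hβ : ∀ᶠ z in 𝓝 (U y), ∀ v, β z v ≤ √(coordGram (H z) v).det)
    (hclosed : extDeriv β (U y) = 0) (hU : ContDiffAt ℝ 2 U y) (hN : ∀ z, 0 ≤ N z)
    (hε : ε ^ 2 = 1) (hK : 0 < K)
    (hmet : ∀ᶠ z in 𝓝 y, coordGram (H (U z)) (fun i => fderiv ℝ U z (EuclideanSpace.single i 1))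
      = (N z / K) ^ 2 • g z)
    (hform : ∀ᶠ z in 𝓝 y, β (U z) (fun i => fderiv ℝ U z (EuclideanSpace.single i 1))
      = (N z / K) ^ (m + 2) * (ε * √(g z).det)) :
    (∀ i a, DifferentiableAt ℝ
      (fun z => N z ^ m * fderiv ℝ U z (EuclideanSpace.single i 1) a) y) ∧
    ∀ a, ∑ i, ∑ j, (g y)⁻¹ i j *
      (pderiv i (fun z => N z ^ m * fderiv ℝ U z (EuclideanSpace.single j 1) a) y
        - ∑ l, christoffelSum (g y)⁻¹ (fun p q r => pderiv p (fun z => g z q r) y) l i j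
            * (N y ^ m * fderiv ℝ U y (EuclideanSpace.single l 1) a)
        + ∑ c, ∑ d, christoffelSum (H (U y))⁻¹ (fun p q r => pderiv p (fun z => H z q r) (U y)) a c d
            * fderiv ℝ U y (EuclideanSpace.single i 1) c
            * (N y ^ m * fderiv ℝ U y (EuclideanSpace.single j 1) d)) = 0 := by
  have hUd := hU.differentiableAt two_ne_zero
  have hUc := hUd.continuousAt
  have hgy := hgp.self_of_nhds
  have hHy := hHp.self_of_nhds
  have hspos : 0 < √(g y).det := Real.sqrt_pos.2 hgy.det_pos
  have hsd : DifferentiableAt ℝ (fun z => √(g z).det) y :=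
    (differentiableAt_det hg).sqrt hgy.det_pos.ne'
  have hHU : ∀ a b, DifferentiableAt ℝ (fun z => H (U z) a b) y := fun a b => (hH a b).comp y hUd
  let V : EuclideanSpace ℝ (Fin (m + 2)) → Fin (m + 2) → EuclideanSpace ℝ (Fin n) :=
    fun z i => fderiv ℝ U z (EuclideanSpace.single i 1)
  let F : EuclideanSpace ℝ (Fin (m + 2)) → Fin (m + 2) → Fin n → ℝ := fun z i a => N z ^ m * V z i a
  -- The factor `K^m` turns `(N/K)^m` into the `N^m` of the flux, and `ε` removes the orientation
  -- sign.
  let W : EuclideanSpace ℝ (Fin (m + 2)) → Fin n → Fin (m + 2) → ℝ := fun z b j =>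
    K ^ m * ε * β (U z) (Function.update (V z) j (EuclideanSpace.single b 1))
  have hWd : ∀ b j, DifferentiableAt ℝ (fun z => W z b j) y := fun b j =>
    ((sum_fderiv_apply_update hU hβd hclosed _).1 j).const_mul _
  have hdivW : ∀ b, ∑ l, pderiv l (fun z => W z b l) y
      = K ^ m * ε * fderiv ℝ β (U y) (EuclideanSpace.single b 1) (V y) := by
    intro b
    have h := sum_fderiv_apply_update hU hβd hclosed (EuclideanSpace.single b 1)
    rw [← h.2, Finset.mul_sum]
    refine Finset.sum_congr rfl fun l _ => ?_
    rw [pderiv, fderiv_const_mul (h.1 l)]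
    rfl
  -- the first cousin principle, near `y`
  have hW : ∀ᶠ z in 𝓝 y, ∀ b j, W z b j
      = √(g z).det * ∑ i, (g z)⁻¹ j i * ∑ a, H (U z) a b * F z i a := by
    filter_upwards [hgp, hUc.eventually hHp, hUc.eventually hβ, hmet, hform]
      with z h1 h2 h3 h4 h5 b j
    have h6 := apply_update_eq_of_calibrated h2 h3 h1 (div_nonneg (hN z) hK.le) hε h4 h5 j
      (EuclideanSpace.single b 1)
    have h7 : ∀ q, ∑ a, ∑ d, H (U z) a d * (EuclideanSpace.single b (1:ℝ)) a * V z q d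
        = ∑ a, H (U z) a b * V z q a := by
      intro q
      rw [Finset.sum_eq_single b (fun a _ hab => by simp [hab]) (by simp)]
      refine Finset.sum_congr rfl fun a _ => ?_
      rw [← h2.isHermitian.apply a b]; simp
    simp only [W, mul_assoc]
    rw [h6]
    simp only [V] at h7
    simp_rw [h7, F, Finset.mul_sum]
    refine Finset.sum_congr rfl fun q _ => Finset.sum_congr rfl fun a _ => ?_
    rw [div_pow]
    field_simp
    rfl
  -- Lowering the domain index gives an identity free of `g⁻¹`. It holds near `y`, not just at `y`,
  -- because it is differentiated below.
  have hlow : ∀ᶠ z in 𝓝 y, ∀ b i, √(g z).det * ∑ a, H (U z) a b * F z i a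
      = ∑ j, g z i j * W z b j := by
    filter_upwards [hW, hgp] with z h1 h2 b i
    let P : Fin (m + 2) → ℝ := fun q => ∑ a, H (U z) a b * F z q a
    have h3 : (fun j => W z b j) = √(g z).det • (g z)⁻¹.mulVec P := by
      funext j; rw [h1]; rfl
    have h4 : (g z).mulVec (fun j => W z b j) = √(g z).det • P := by
      rw [h3, Matrix.mulVec_smul, Matrix.mulVec_mulVec,
        Matrix.mul_nonsing_inv _ (isUnit_iff_ne_zero.2 h2.det_pos.ne'), Matrix.one_mulVec]
    exact (congrFun h4 i).symm
  -- `N` is not assumed differentiable: the flux is recovered from `W` by inverting `H` and dividing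
  -- by `√det g`, both nondegenerate near `y`.
  have hFd : ∀ i a, DifferentiableAt ℝ (fun z => F z i a) y := by
    intro i a
    have h1 : (fun z => F z i a) =ᶠ[𝓝 y] fun z => ∑ b, (H (U z))⁻¹ a b *
        ((√(g z).det)⁻¹ * ∑ j, g z i j * W z b j) := by
      filter_upwards [hlow, hgp, hUc.eventually hHp] with z h1 h2 h3
      have hs : √(g z).det ≠ 0 := (Real.sqrt_pos.2 h2.det_pos).ne'
      have h4 : ((H (U z))⁻¹ * H (U z)).mulVec (F z i) = F z i := by
        rw [Matrix.nonsing_inv_mul _ (isUnit_iff_ne_zero.2 h3.det_pos.ne'), Matrix.one_mulVec]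
      rw [← Matrix.mulVec_mulVec] at h4
      refine (congrFun h4 a).symm.trans ?_
      simp only [Matrix.mulVec, dotProduct]
      refine Finset.sum_congr rfl fun b _ => ?_
      rw [← h1, inv_mul_cancel_left₀ hs]
      congr 1
      refine Finset.sum_congr rfl fun c _ => ?_
      rw [← h3.isHermitian.apply b c, star_trivial]
    refine DifferentiableAt.congr_of_eventuallyEq ?_ h1
    refine DifferentiableAt.fun_sum fun b _ => ?_
    refine (differentiableAt_inv_apply hHU hHy.det_pos.ne' a b).mul ?_
    refine (hsd.inv hspos.ne').mul (DifferentiableAt.fun_sum fun j _ => (hg i j).mul (hWd b j))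
  refine ⟨hFd, ?_⟩
  have hhsymm : ∀ a b, H (U y) a b = H (U y) b a := fun a b => by
    rw [← hHy.isHermitian.apply a b, star_trivial]
  have hgsymm : ∀ a b, (g y)⁻¹ a b = (g y)⁻¹ b a := fun a b => by
    rw [← hgy.isHermitian.inv.apply a b, star_trivial]
  refine divergence_eq_zero (h := H (U y)) (F := F y) (u := fun i a => V y i a) (W := W y)
    (ds := fun l => pderiv l (fun z => √(g z).det) y)
    (dF := fun i j a => pderiv i (fun z => F z j a) y)
    (dW := fun b l j => pderiv l (fun z => W z b j) y)
    (Matrix.nonsing_inv_mul _ (isUnit_iff_ne_zero.2 hgy.det_pos.ne')) hgsymm hspos.ne' ?_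
    (Matrix.mul_nonsing_inv _ (isUnit_iff_ne_zero.2 hHy.det_pos.ne')) hhsymm
    (fun i a => rfl) hW.self_of_nhds ?_ ?_
  · exact fun l => fderiv_sqrt_det hg hgy _
  · intro b l i
    have h1 : (fun z => √(g z).det * ∑ a, H (U z) a b * F z i a)
        =ᶠ[𝓝 y] fun z => ∑ j, g z i j * W z b j := hlow.mono fun z hz => hz b i
    have h2 := pderiv_congr l h1
    rw [pderiv_mul hsd (DifferentiableAt.fun_sum fun a _ => (hHU a b).fun_mul (hFd i a)),
      pderiv_sum fun a => (hHU a b).fun_mul (hFd i a),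
      pderiv_sum fun j => (hg i j).fun_mul (hWd b j)] at h2
    simp_rw [fun a => pderiv_mul (i := l) (hHU a b) (hFd i a),
      fun j => pderiv_mul (i := l) (hg i j) (hWd b j), Finset.sum_add_distrib,
      fun a => pderiv_comp hUd (hH a b) l] at h2
    exact h2
  -- Closedness has reduced the divergence of `W` to `(∂_b β)(v)`; the variation of the base point
  -- now expresses it through `∂_b H`.
  · intro b
    rw [hdivW]
    have h1 := fderiv_apply_eq_of_calibrated hH hβd hHp hβ hgy (div_nonneg (hN y) hK.le) hε
      hmet.self_of_nhds hform.self_of_nhds (EuclideanSpace.single b 1)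
    have h2 : K ^ m * ε * fderiv ℝ β (U y) (EuclideanSpace.single b 1) (V y)
        = 1 / 2 * K ^ m * (2 * (ε * fderiv ℝ β (U y) (EuclideanSpace.single b 1) (V y))) := by ring
    rw [h2]
    simp only [V]
    rw [h1, div_pow]
    simp_rw [Finset.mul_sum]
    refine Finset.sum_congr rfl fun i _ => Finset.sum_congr rfl fun j _ =>
      Finset.sum_congr rfl fun c _ => Finset.sum_congr rfl fun d _ => ?_
    simp only [F, V, pderiv]
    field_simp

end Local


/-! ### Smith immersions in coordinates -/

/-- The calibration inequality is applied to the images of `v` under the derivative of `ψ.symm`,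
whose Gram matrix is by bilinearity the coordinate one. -/
theorem formInChart_le {k n : ℕ} {M : Type*}
    [TopologicalSpace M] [ChartedSpace (EuclideanSpace ℝ (Fin n)) M]
    [Bundle.RiemannianBundle (fun x : M ↦ TangentSpace (𝓡 n) x)] {α : RoughForm k n M}
    (hα : IsCalibration α) (ψ : OpenPartialHomeomorph M (EuclideanSpace ℝ (Fin n)))
    (z : EuclideanSpace ℝ (Fin n)) (v : Fin k → EuclideanSpace ℝ (Fin n)) :
    formInChart α ψ z v ≤ √(coordGram (metricMatrix ψ z) v).det := by
  let A : EuclideanSpace ℝ (Fin n) →L[ℝ] TangentSpace (𝓡 n) (ψ.symm z) :=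
    mfderiv (𝓡 n) (𝓡 n) ψ.symm z
  have hA : ∀ w : EuclideanSpace ℝ (Fin n), A w = ∑ a, w a • coordVec ψ a z := by
    intro w
    have h2 : ∑ a, w a • (EuclideanSpace.single a (1:ℝ) : EuclideanSpace ℝ (Fin n)) = w := by
      simpa using (EuclideanSpace.basisFun (Fin n) ℝ).sum_repr w
    conv_lhs => rw [← h2, map_sum]
    simp_rw [map_smul]
    rfl
  have h := hα.le (ψ.symm z) (fun i => A (v i))
  have hgram : Matrix.gram ℝ (fun i => A (v i)) = coordGram (metricMatrix ψ z) v := by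
    ext i j
    rw [Matrix.gram_apply, hA, hA]
    exact inner_sum_smul_sum_smul _ _ _
  rw [hgram] at h
  exact h

section

variable {k n : ℕ} {L M : Type*}
    [TopologicalSpace L] [ChartedSpace (EuclideanSpace ℝ (Fin k)) L]
    [Bundle.RiemannianBundle (fun x : L ↦ TangentSpace (𝓡 k) x)]
    [TopologicalSpace M] [ChartedSpace (EuclideanSpace ℝ (Fin n)) M]
    [Bundle.RiemannianBundle (fun x : M ↦ TangentSpace (𝓡 n) x)]
    {φ : OpenPartialHomeomorph L (EuclideanSpace ℝ (Fin k))}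
    {ψ : OpenPartialHomeomorph M (EuclideanSpace ℝ (Fin n))}
    {o : ManifoldOrientation k L} {α : RoughForm k n M} {u : L → M}
    {y : EuclideanSpace ℝ (Fin k)}

theorem IsSmithImmersion.coordGram_eq (hu : IsSmithImmersion o α u)
    (hφ : φ.MDifferentiable (𝓡 k) (𝓡 k)) (hψ : ψ.MDifferentiable (𝓡 n) (𝓡 n))
    (hy : y ∈ φ.target) (huy : u (φ.symm y) ∈ ψ.source) :
    coordGram (metricMatrix ψ (ψ (u (φ.symm y))))
        (fun i => fderiv ℝ (fun z => ψ (u (φ.symm z))) y (EuclideanSpace.single i 1))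
      = (normDu k n u (φ.symm y) / √(k : ℝ)) ^ 2 • metricMatrix φ y := by
  ext i j
  have h1 := hu.pullback_metric (φ.symm y) (coordVec φ i y) (coordVec φ j y)
  rw [inner_eq_sum_metricMatrix hψ huy] at h1
  have hmd := hu.smooth.mdifferentiable (by simp)
  simp only [coordGram, Matrix.of_apply, ← mfderiv_chart_comp hφ hψ hmd hy huy]
  refine h1.trans ?_
  rw [div_pow, Real.sq_sqrt (Nat.cast_nonneg k), Matrix.smul_apply, smul_eq_mul, metricMatrix,
    Matrix.gram_apply, one_div_mul_eq_div]

open Classical in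
theorem IsSmithImmersion.formInChart_eq (hk : 0 < k) (hu : IsSmithImmersion o α u)
    (hφ : φ.MDifferentiable (𝓡 k) (𝓡 k)) (hψ : ψ.MDifferentiable (𝓡 n) (𝓡 n))
    (hy : y ∈ φ.target) (huy : u (φ.symm y) ∈ ψ.source) :
    formInChart α ψ (ψ (u (φ.symm y)))
        (fun i => fderiv ℝ (fun z => ψ (u (φ.symm z))) y (EuclideanSpace.single i 1))
      = (normDu k n u (φ.symm y) / √(k : ℝ)) ^ k *
        ((if IsPositiveFrame o.orient φ y then 1 else -1) * √(metricMatrix φ y).det) := by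
  have h1 := hu.pullback_form (φ.symm y) (fun i => coordVec φ i y)
  rw [form_eq_formInChart α hψ huy, volumeForm_coordVec hk o.orient hφ hy] at h1
  have hmd := hu.smooth.mdifferentiable (by simp)
  simp only [← mfderiv_chart_comp hφ hψ hmd hy huy]
  refine h1.trans ?_
  rw [div_pow, one_div_mul_eq_div]

/-- A real exponent that equals a natural number makes the flux a polynomial factor times `du`; for
`m = 0` the factor is `1` also where `du = 0`. -/
theorem sectionComp_pFlux {m : ℕ} {p : ℝ} (hp : p - 2 = m)
    (hu : MDifferentiable (𝓡 k) (𝓡 n) u)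
    (hφ : φ.MDifferentiable (𝓡 k) (𝓡 k)) (hψ : ψ.MDifferentiable (𝓡 n) (𝓡 n))
    (hy : y ∈ φ.target) (huy : u (φ.symm y) ∈ ψ.source) (a : Fin n) (j : Fin k) :
    sectionComp (pFlux k n p u) φ ψ a j y = normDu k n u (φ.symm y) ^ m *
      fderiv ℝ (fun z => ψ (u (φ.symm z))) y (EuclideanSpace.single j 1) a := by
  rw [← mfderiv_chart_comp hφ hψ hu hy huy, sectionComp, pFlux, hp, Real.rpow_natCast]
  let A : TangentSpace (𝓡 n) (u (φ.symm y)) →L[ℝ] EuclideanSpace ℝ (Fin n) :=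
    mfderiv (𝓡 n) (𝓡 n) ψ (u (φ.symm y))
  exact congrFun (congrArg _ (map_smul A (normDu k n u (φ.symm y) ^ m)
    (mfderiv (𝓡 k) (𝓡 n) u (φ.symm y) (coordVec φ j y)))) a

end

end SmithMaps

theorem mainTheorem6 {k n : ℕ} (hk : 2 ≤ k)
    {L : Type*} [TopologicalSpace L] [ChartedSpace (EuclideanSpace ℝ (Fin k)) L]
    [IsManifold (𝓡 k) ∞ L]
    [Bundle.RiemannianBundle (fun x : L ↦ TangentSpace (𝓡 k) x)]
    [IsContMDiffRiemannianBundle (𝓡 k) ∞ (EuclideanSpace ℝ (Fin k))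
      (fun x : L ↦ TangentSpace (𝓡 k) x)]
    {M : Type*} [TopologicalSpace M] [ChartedSpace (EuclideanSpace ℝ (Fin n)) M]
    [IsManifold (𝓡 n) ∞ M]
    [Bundle.RiemannianBundle (fun x : M ↦ TangentSpace (𝓡 n) x)]
    [IsContMDiffRiemannianBundle (𝓡 n) ∞ (EuclideanSpace ℝ (Fin n))
      (fun x : M ↦ TangentSpace (𝓡 n) x)]
    (o : SmithMaps.ManifoldOrientation k L)
    (α : SmithMaps.RoughForm k n M) (hα : SmithMaps.IsCalibration α)
    (hclosed : SmithMaps.IsClosedForm α)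
    (u : L → M) (hu : SmithMaps.IsSmithImmersion o α u) :
    SmithMaps.IsPHarmonic k n (k : ℝ) u := by
  classical
  obtain ⟨m, rfl⟩ := Nat.exists_eq_add_of_le' hk
  intro φ hφ ψ hψ x hx hux
  have hφd := SmithMaps.mdifferentiable_of_mem_smoothCharts hφ
  have hψd := SmithMaps.mdifferentiable_of_mem_smoothCharts hψ
  have hmd := hu.smooth.mdifferentiable (by simp)
  have hy : φ x ∈ φ.target := φ.map_source hx
  have huy : u (φ.symm (φ x)) ∈ ψ.source := by rwa [φ.left_inv hx]
  set y := φ x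
  have hzt : ∀ᶠ z in 𝓝 y, z ∈ φ.target := φ.open_target.mem_nhds hy
  have hzs : ∀ᶠ z in 𝓝 y, u (φ.symm z) ∈ ψ.source :=
    (hu.smooth.continuous.continuousAt.comp (φ.continuousAt_symm hy)).eventually
      (ψ.open_source.mem_nhds huy)
  have hwt : ∀ᶠ w in 𝓝 (ψ (u (φ.symm y))), w ∈ ψ.target :=
    ψ.open_target.mem_nhds (ψ.map_source huy)
  have hU := SmithMaps.contDiffAt_chart_comp hφ hψ hu.smooth hy huy
  have hp : ((m + 2 : ℕ) : ℝ) - 2 = m := by push_cast; ring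
  have key := SmithMaps.local_divergence (g := SmithMaps.metricMatrix φ)
    (H := SmithMaps.metricMatrix ψ) (U := fun z => ψ (u (φ.symm z)))
    (β := SmithMaps.formInChart α ψ) (N := fun z => SmithMaps.normDu (m + 2) n u (φ.symm z))
    -- The sign is frozen at `y`; local constancy of the orientation makes it the right sign at all
    -- nearby points.
    (ε := if SmithMaps.IsPositiveFrame o.orient φ y then 1 else -1)
    (K := √((m + 2 : ℕ) : ℝ)) (y := y)
    (SmithMaps.differentiableAt_metricMatrix hφ hy)
    (hzt.mono fun z hz => SmithMaps.posDef_metricMatrix hφ hz)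
    (SmithMaps.differentiableAt_metricMatrix hψ hwt.self_of_nhds)
    (hwt.mono fun w hw => SmithMaps.posDef_metricMatrix hψ hw)
    (((hα.smooth ψ hψ).contDiffAt hwt).differentiableAt (by simp))
    (Filter.Eventually.of_forall fun w v => SmithMaps.formInChart_le hα ψ w v)
    (hclosed ψ hψ _ hwt.self_of_nhds) (hU.of_le (by norm_cast))
    (fun z => Real.sqrt_nonneg _) (by split_ifs <;> norm_num)
    (Real.sqrt_pos.2 (by positivity))
    (by filter_upwards [hzt, hzs] with z h1 h2 using hu.coordGram_eq hφd hψd h1 h2)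
    (by
      filter_upwards [hzt, hzs, o.locally_constant φ hφ y hy] with z h1 h2 h3
      rw [hu.formInChart_eq (by omega) hφd hψd h1 h2]
      simp only [h3])
  have hsec : ∀ a j, SmithMaps.sectionComp (SmithMaps.pFlux (m + 2) n ((m + 2 : ℕ) : ℝ) u) φ ψ a j
      =ᶠ[𝓝 y] fun z => SmithMaps.normDu (m + 2) n u (φ.symm z) ^ m *
        fderiv ℝ (fun z => ψ (u (φ.symm z))) z (EuclideanSpace.single j 1) a := fun a j => by
    filter_upwards [hzt, hzs] with z h1 h2
    exact SmithMaps.sectionComp_pFlux hp hmd hφd hψd h1 h2 a j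
  refine ⟨fun a j => (key.1 j a).congr_of_eventuallyEq (hsec a j), fun a => ?_⟩
  rw [← key.2 a, SmithMaps.pTensionComp, SmithMaps.divergenceComp]
  refine Finset.sum_congr rfl fun i _ => Finset.sum_congr rfl fun j _ => ?_
  rw [SmithMaps.covDerivComp, SmithMaps.pderiv_congr i (hsec a j)]
  simp_rw [(hsec _ _).eq_of_nhds, SmithMaps.pderiv_apply (hU.differentiableAt (by simp))]
  rfl
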